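/- Let $L=\{L(x,y);\,x,y\ge 0\}$ be a real-valued Lévy sheet with exponent $\Psi:\mathbb R\to\mathbb C$ on a probability space $(\Omega,\mathcal F,\mathbb P_0)$: $L$ is continuous in probability; $L(x,0)=0$ a.s. for every $x\ge 0$ and $L(0,y)=0$ a.s. for every $y\ge0$; the increments of $L$ over finitely many disjoint rectangles $(s,s']\times(t,t']$ of $\mathbb R_+^2$ are independent; and, for every such rectangle $Q$, $\mathbb E[e^{i\xi\Delta_QL}]=e^{-\lambda(Q)\Psi(\xi)}$ for all $\xi\in\mathbb R$, where $\Delta_QL$ is the rectangular increment and $\lambda$ is Lebesgue measure. Assume that $L$ is jointly measurable in $(x,y,\omega)$. Write $\Psi=a+ib$ with $a,b$ real-valued. Let $S,T>0$ and $\theta\in(0,2\pi)$ with $a(\theta)\neq0$, and define, for $\varepsilon>0$ and $(s,t)\in[0,S]\times[0,T]$, $$X_\varepsilon(s,t)=\varepsilon K\int_0^{t/\varepsilon}\int_0^{s/\varepsilon}\sqrt{xy}\,\{\cos(\theta L(x,y))+i\sin(\theta L(x,y))\}\,dx\,dy,\qquad K=\frac1{\sqrt2}\,\frac{a(\theta)^2+b(\theta)^2}{a(\theta)}.$$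 Let $\mathbb P_\varepsilon$ be the law of $X_\varepsilon$ in $\mathcal C([0,S]\times[0,T];\mathbb C)$. Let $\varepsilon_n>0$, $\varepsilon_n\to0$, and suppose that $\mathbb P_{\varepsilon_n}$ converges weakly to a probability measure $\mathbb P$ on $\mathcal C([0,S]\times[0,T];\mathbb C)$. Let $X$ be the canonical process on this space and let $\mathcal F_{s,t}=\sigma(X(u,v);\,u\le s,\ v\le t)$ be its natural filtration. Then, under $\mathbb P$, the real and the imaginary part of $X$ are strong martingales with respect to $\{\mathcal F_{s,t}\}$, and also with respect to its augmentation, obtained by adding the $\mathbb P$-null sets to every $\mathcal F_{s,t}$ and then replacing the filtration by its right-continuous version $\bigcap_{s'>s,\,t'>t}\mathcal F_{s',t'}$ (with $s'=S$ allowed if $s=S$, and $t'=T$ allowed if $t=T$). Here a real-valued process $Y$ on $[0,S]\times[0,T]$ is a strong martingale with respect to a filtration $\{\mathcal G_{s,t}\}$ if it is adapted, $\mathbb E|Y(s,t)|<\infty$ for all $(s,t)$, almost surely $Y(s,0)=Y(0,t)=0$ for all $s,t$, and $\mathbb E[Y(s',t')-Y(s,t')-Y(s',t)+Y(s,t)\mid\mathcal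 G_{S,t}\vee\mathcal G_{s,T}]=0$ for all $s<s'$ and $t<t'$. -/

import Mathlib

open MeasureTheory ProbabilityTheory Filter Topology
open scoped NNReal

noncomputable section

/-! ## Lévy sheets -/

/-- A (nondegenerate) rectangle `(s, s'] × (t, t']` of the quadrant `ℝ₊²`. -/
structure QuadrantRect where
  s : ℝ≥0
  s' : ℝ≥0
  t : ℝ≥0
  t' : ℝ≥0
  hs : s < s'
  ht : t < t'

namespace QuadrantRect

/-- The underlying set of points. -/
def toSet (Q : QuadrantRect) : Set (ℝ≥0 × ℝ≥0) := Set.Ioc Q.s Q.s' ×ˢ Set.Ioc Q.t Q.t'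

/-- The Lebesgue measure `λ(Q)`. -/
def area (Q : QuadrantRect) : ℝ := ((Q.s' : ℝ) - Q.s) * ((Q.t' : ℝ) - Q.t)

/-- The increment `Δ_Q Y` of a random field over the rectangle `Q`. -/
def increment {Ω : Type*} (Q : QuadrantRect) (Y : ℝ≥0 → ℝ≥0 → Ω → ℝ) (ω : Ω) : ℝ :=
  Y Q.s' Q.t' ω - Y Q.s Q.t' ω - Y Q.s' Q.t ω + Y Q.s Q.t ω

end QuadrantRect

/-- `L` is a Lévy sheet with exponent `Ψ` under `μ`. As usual, a Lévy sheet is null on the axes.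
The functions `a` and `b` in `Ψ = a + i b` are the real and imaginary parts of `Ψ`. -/
structure IsLevySheet {Ω : Type*} [MeasurableSpace Ω] (L : ℝ≥0 → ℝ≥0 → Ω → ℝ) (Ψ : ℝ → ℂ)
    (μ : Measure Ω) : Prop where
  /-- continuity in probability -/
  continuous_in_probability : ∀ z : ℝ≥0 × ℝ≥0,
    TendstoInMeasure μ (fun w : ℝ≥0 × ℝ≥0 => L w.1 w.2) (𝓝 z) (L z.1 z.2)
  /-- the sheet vanishes on the axes -/
  zero_left : ∀ y, ∀ᵐ ω ∂μ, L 0 y ω = 0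
  zero_right : ∀ x, ∀ᵐ ω ∂μ, L x 0 ω = 0
  /-- the increments over disjoint rectangles are independent -/
  indep_increments : ∀ (n : ℕ) (Q : Fin n → QuadrantRect),
    (∀ i j, i ≠ j → Disjoint (Q i).toSet (Q j).toSet) →
      iIndepFun (fun i => (Q i).increment L) μ
  /-- `E[exp(i ξ Δ_Q L)] = exp(-λ(Q) Ψ(ξ))` -/
  char_increment : ∀ (Q : QuadrantRect) (ξ : ℝ),
    ∫ ω, Complex.exp (Complex.I * ((ξ * Q.increment L ω : ℝ) : ℂ)) ∂μ
      = Complex.exp (-(Q.area : ℂ) * Ψ ξ)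

/-! ## The random fields `X_ε` and their laws -/

/-- The parameter set `[0,S] × [0,T]`, with the product (partial) order. -/
abbrev ParamRect (S T : ℝ) : Type := Set.Icc (0 : ℝ) S × Set.Icc (0 : ℝ) T

/-- The space `C([0,S] × [0,T]; ℂ)` with the topology of uniform convergence. -/
abbrev PathSpace (S T : ℝ) : Type := C(ParamRect S T, ℂ)

instance pathSpaceMeasurableSpace (S T : ℝ) : MeasurableSpace (PathSpace S T) :=
  borel (PathSpace S T)

instance pathSpaceBorelSpace (S T : ℝ) : BorelSpace (PathSpace S T) := ⟨rfl⟩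

/-- `√(xy) {cos(θ L(x,y)) + i sin(θ L(x,y))}`, for `x, y ≥ 0`. -/
def levyIntegrand {Ω : Type*} (L : ℝ≥0 → ℝ≥0 → Ω → ℝ) (θ : ℝ) (ω : Ω) (x y : ℝ) : ℂ :=
  (Real.sqrt (x * y) : ℂ) *
    ((Real.cos (θ * L x.toNNReal y.toNNReal ω) : ℂ)
      + Complex.I * (Real.sin (θ * L x.toNNReal y.toNNReal ω) : ℂ))

/-- `K = (1/√2) (a(θ)² + b(θ)²) / a(θ)` where `Ψ = a + i b`. -/
def levyConst (Ψ : ℝ → ℂ) (θ : ℝ) : ℝ :=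
  1 / Real.sqrt 2 * (((Ψ θ).re ^ 2 + (Ψ θ).im ^ 2) / (Ψ θ).re)

/-- `X_ε(s,t) = ε K ∫_0^{t/ε} ∫_0^{s/ε} √(xy) {cos(θ L(x,y)) + i sin(θ L(x,y))} dx dy`. -/
def levyField {Ω : Type*} (L : ℝ≥0 → ℝ≥0 → Ω → ℝ) (Ψ : ℝ → ℂ) (θ ε s t : ℝ) (ω : Ω) : ℂ :=
  (ε : ℂ) * (levyConst Ψ θ : ℂ) *
    ∫ y in (0 : ℝ)..(t / ε), ∫ x in (0 : ℝ)..(s / ε), levyIntegrand L θ ω x y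

section Regularity

theorem norm_levyIntegrand_le {Ω : Type*} (L : ℝ≥0 → ℝ≥0 → Ω → ℝ) (θ : ℝ) (ω : Ω) (x y : ℝ) :
    ‖levyIntegrand L θ ω x y‖ ≤ Real.sqrt (x * y) * 2 := by
  unfold levyIntegrand
  rw [norm_mul, Complex.norm_real, Real.norm_of_nonneg (Real.sqrt_nonneg _)]
  gcongr
  refine (norm_add_le _ _).trans ?_
  rw [norm_mul, Complex.norm_I, one_mul, Complex.norm_real, Complex.norm_real]
  have h1 := Real.abs_cos_le_one (θ * L x.toNNReal y.toNNReal ω)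
  have h2 := Real.abs_sin_le_one (θ * L x.toNNReal y.toNNReal ω)
  rw [Real.norm_eq_abs, Real.norm_eq_abs]
  linarith

theorem norm_levyIntegrand_le_box {Ω : Type*} (L : ℝ≥0 → ℝ≥0 → Ω → ℝ) (θ : ℝ) (ω : Ω) {A B x y : ℝ}
    (hx : x ∈ Set.Ioc 0 A) (hy : y ∈ Set.Ioc 0 B) :
    ‖levyIntegrand L θ ω x y‖ ≤ Real.sqrt (A * B) * 2 := by
  refine (norm_levyIntegrand_le L θ ω x y).trans ?_
  have : x * y ≤ A * B := mul_le_mul hx.2 hy.2 hy.1.le (hx.1.le.trans hx.2)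
  gcongr

variable {Ω : Type*} [MeasurableSpace Ω] {L : ℝ≥0 → ℝ≥0 → Ω → ℝ}

theorem measurable_levyIntegrand
    (hL : Measurable fun p : (ℝ≥0 × ℝ≥0) × Ω => L p.1.1 p.1.2 p.2) (θ : ℝ) :
    Measurable fun q : Ω × (ℝ × ℝ) => levyIntegrand L θ q.1 q.2.1 q.2.2 := by
  have h1 : Measurable fun q : Ω × (ℝ × ℝ) => L q.2.1.toNNReal q.2.2.toNNReal q.1 :=
    hL.comp (f := fun q : Ω × (ℝ × ℝ) => ((q.2.1.toNNReal, q.2.2.toNNReal), q.1)) (by fun_prop)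
  unfold levyIntegrand
  have h2 : Measurable fun q : Ω × (ℝ × ℝ) => Real.sqrt (q.2.1 * q.2.2) := by fun_prop
  have h3 := Real.measurable_cos.comp (h1.const_mul θ)
  have h4 := Real.measurable_sin.comp (h1.const_mul θ)
  exact (Complex.measurable_ofReal.comp h2).mul ((Complex.measurable_ofReal.comp h3).add
    (measurable_const.mul (Complex.measurable_ofReal.comp h4)))

theorem integrableOn_levyIntegrand
    (hL : Measurable fun p : (ℝ≥0 × ℝ≥0) × Ω => L p.1.1 p.1.2 p.2) (θ : ℝ) (ω : Ω) (A B : ℝ) :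
    IntegrableOn (fun p : ℝ × ℝ => levyIntegrand L θ ω p.2 p.1)
      (Set.Ioc 0 B ×ˢ Set.Ioc 0 A) := by
  have hm : Measurable fun p : ℝ × ℝ => levyIntegrand L θ ω p.2 p.1 :=
    (measurable_levyIntegrand hL θ).comp (f := fun p : ℝ × ℝ => (ω, (p.2, p.1))) (by fun_prop)
  refine Measure.integrableOn_of_bounded (M := Real.sqrt (A * B) * 2) ?_ hm.aestronglyMeasurable ?_
  · rw [Measure.volume_eq_prod, Measure.prod_prod]
    exact (ENNReal.mul_lt_top measure_Ioc_lt_top measure_Ioc_lt_top).ne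
  · refine (ae_restrict_mem (measurableSet_Ioc.prod measurableSet_Ioc)).mono ?_
    rintro ⟨y, x⟩ ⟨hy, hx⟩
    exact norm_levyIntegrand_le_box L θ ω hx hy

/-- The iterated integral as an integral over a fixed box. -/
theorem iterated_eq_box
    (hL : Measurable fun p : (ℝ≥0 × ℝ≥0) × Ω => L p.1.1 p.1.2 p.2) (θ : ℝ) (ω : Ω)
    {A B s t : ℝ} (hs : s ∈ Set.Icc 0 A) (ht : t ∈ Set.Icc 0 B) :
    ∫ y in (0 : ℝ)..t, ∫ x in (0 : ℝ)..s, levyIntegrand L θ ω x y =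
      ∫ p in Set.Ioc 0 B ×ˢ Set.Ioc 0 A,
        (Set.Ioc 0 t ×ˢ Set.Ioc 0 s).indicator
          (fun p : ℝ × ℝ => levyIntegrand L θ ω p.2 p.1) p := by
  rw [setIntegral_indicator (measurableSet_Ioc.prod measurableSet_Ioc),
    Set.inter_eq_right.2
      (Set.prod_mono (Set.Ioc_subset_Ioc_right ht.2) (Set.Ioc_subset_Ioc_right hs.2)),
    Measure.volume_eq_prod, setIntegral_prod]
  · rw [intervalIntegral.integral_of_le ht.1]
    simp_rw [intervalIntegral.integral_of_le hs.1]
  · rw [← Measure.volume_eq_prod]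
    exact integrableOn_levyIntegrand hL θ ω s t

theorem continuous_levyField
    (hL : Measurable fun p : (ℝ≥0 × ℝ≥0) × Ω => L p.1.1 p.1.2 p.2) (Ψ : ℝ → ℂ) (θ : ℝ)
    {ε : ℝ} (hε : 0 < ε) (S T : ℝ) (ω : Ω) :
    Continuous fun z : ParamRect S T => levyField L Ψ θ ε z.1 z.2 ω := by
  unfold levyField
  refine continuous_const.mul ?_
  have hmem : ∀ {R : ℝ} (u : Set.Icc (0 : ℝ) R), (u : ℝ) / ε ∈ Set.Icc 0 (R / ε) := fun u =>
    ⟨div_nonneg u.2.1 hε.le, div_le_div_of_nonneg_right u.2.2 hε.le⟩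
  have heq : ∀ z : ParamRect S T, _ := fun z =>
    iterated_eq_box hL θ ω (hmem z.1) (hmem z.2)
  simp_rw [heq]
  have hm : Measurable fun p : ℝ × ℝ => levyIntegrand L θ ω p.2 p.1 :=
    (measurable_levyIntegrand hL θ).comp (f := fun p : ℝ × ℝ => (ω, (p.2, p.1))) (by fun_prop)
  rw [continuous_iff_continuousAt]
  intro z
  refine continuousAt_of_dominated (bound := fun p => ‖levyIntegrand L θ ω p.2 p.1‖) ?_ ?_ ?_ ?_
  · exact Eventually.of_forall fun w =>
      (hm.indicator (measurableSet_Ioc.prod measurableSet_Ioc)).aestronglyMeasurable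
  · exact Eventually.of_forall fun w => Eventually.of_forall fun p => norm_indicator_le_norm_self _ _
  · exact (integrableOn_levyIntegrand hL θ ω (S / ε) (T / ε)).norm
  · refine ae_restrict_of_ae ?_
    have h1 : ∀ᵐ p : ℝ × ℝ, p.1 ≠ (z.2 : ℝ) / ε := by
      rw [Measure.volume_eq_prod]
      exact Measure.quasiMeasurePreserving_fst.ae (Measure.ae_ne volume _)
    have h2 : ∀ᵐ p : ℝ × ℝ, p.2 ≠ (z.1 : ℝ) / ε := by
      rw [Measure.volume_eq_prod]
      exact Measure.quasiMeasurePreserving_snd.ae (Measure.ae_ne volume _)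
    filter_upwards [h1, h2] with p hp1 hp2
    have key : ∀ {f : ParamRect S T → ℝ} (_ : Continuous f) (c : ℝ), c ≠ f z →
        ∀ᶠ w in 𝓝 z, (c ≤ f w ↔ c ≤ f z) := by
      intro f hf c hc
      rcases lt_or_gt_of_ne hc with h | h
      · filter_upwards [hf.continuousAt.eventually (lt_mem_nhds h)] with w hw
        exact ⟨fun _ => h.le, fun _ => le_of_lt hw⟩
      · filter_upwards [hf.continuousAt.eventually (gt_mem_nhds h)] with w hw
        exact ⟨fun h' => absurd h' (not_le.2 hw), fun h' => absurd h' (not_le.2 h)⟩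
    have e1 := key (f := fun w => (w.2 : ℝ) / ε) (by fun_prop) p.1 hp1
    have e2 := key (f := fun w => (w.1 : ℝ) / ε) (by fun_prop) p.2 hp2
    refine (continuousAt_const (y := (Set.Ioc 0 ((z.2 : ℝ) / ε) ×ˢ
      Set.Ioc 0 ((z.1 : ℝ) / ε)).indicator
        (fun p : ℝ × ℝ => levyIntegrand L θ ω p.2 p.1) p)).congr ?_
    filter_upwards [e1, e2] with w hw1 hw2
    simp only [Set.indicator, Set.mem_prod, Set.mem_Ioc, hw1, hw2]

theorem measurable_levyField
    (hL : Measurable fun p : (ℝ≥0 × ℝ≥0) × Ω => L p.1.1 p.1.2 p.2) (Ψ : ℝ → ℂ) (θ : ℝ)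
    {ε : ℝ} (hε : 0 < ε) {s t : ℝ} (hs : 0 ≤ s) (ht : 0 ≤ t) :
    Measurable fun ω => levyField L Ψ θ ε s t ω := by
  unfold levyField
  refine measurable_const.mul ?_
  have heq : ∀ ω : Ω, _ := fun ω =>
    iterated_eq_box hL θ ω (A := s / ε) (B := t / ε) (s := s / ε) (t := t / ε)
      ⟨div_nonneg hs hε.le, le_rfl⟩ ⟨div_nonneg ht hε.le, le_rfl⟩
  simp_rw [heq]
  refine (StronglyMeasurable.integral_prod_right' (f := fun q : Ω × (ℝ × ℝ) =>
    (Set.Ioc 0 (t / ε) ×ˢ Set.Ioc 0 (s / ε)).indicator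
      (fun p : ℝ × ℝ => levyIntegrand L θ q.1 p.2 p.1) q.2) ?_).measurable
  refine Measurable.stronglyMeasurable ?_
  have hm : Measurable fun q : Ω × (ℝ × ℝ) => levyIntegrand L θ q.1 q.2.2 q.2.1 :=
    (measurable_levyIntegrand hL θ).comp
      (f := fun q : Ω × (ℝ × ℝ) => (q.1, (q.2.2, q.2.1))) (by fun_prop)
  exact hm.indicator
    (measurable_snd (measurableSet_Ioc.prod measurableSet_Ioc))

end Regularity

/-- A map into the path space is Borel measurable as soon as its evaluations are measurable. -/
theorem measurable_pathSpace_of_eval {Ω : Type*} [MeasurableSpace Ω] {S T : ℝ}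
    {X : Ω → PathSpace S T} (h : ∀ z, Measurable fun ω => X ω z) : Measurable X := by
  obtain ⟨D, hDc, hDd⟩ := TopologicalSpace.exists_countable_dense (ParamRect S T)
  have hball : ∀ (f : PathSpace S T) (r : ℝ), 0 ≤ r →
      MeasurableSet (X ⁻¹' Metric.closedBall f r) := by
    intro f r hr
    have : X ⁻¹' Metric.closedBall f r = ⋂ z ∈ D, {ω | dist (X ω z) (f z) ≤ r} := by
      ext ω
      simp only [Set.mem_preimage, Metric.mem_closedBall, ContinuousMap.dist_le hr, Set.mem_iInter,
        Set.mem_ofPred_eq]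
      refine ⟨fun h' z _ => h' z, fun h' z => ?_⟩
      have hcl : IsClosed {z | dist (X ω z) (f z) ≤ r} :=
        isClosed_le (by fun_prop) continuous_const
      exact hcl.closure_subset_iff.2 h' (hDd z)
    rw [this]
    exact MeasurableSet.biInter hDc fun z _ =>
      measurableSet_le ((h z).dist measurable_const) measurable_const
  refine measurable_of_isOpen fun U hU => ?_
  choose! r hr hrU using fun x (hx : x ∈ U) => Metric.nhds_basis_closedBall.mem_iff.1 (hU.mem_nhds hx)
  obtain ⟨C, hC, hCU⟩ := TopologicalSpace.isOpen_iUnion_countable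
    (fun x : U => Metric.ball (x : PathSpace S T) (r x)) fun _ => Metric.isOpen_ball
  have hU' : U = ⋃ x ∈ C, Metric.closedBall (x : PathSpace S T) (r x) := by
    apply Set.Subset.antisymm
    · intro y hy
      have : y ∈ ⋃ x : U, Metric.ball (x : PathSpace S T) (r x) :=
        Set.mem_iUnion.2 ⟨⟨y, hy⟩, Metric.mem_ball_self (hr y hy)⟩
      rw [← hCU] at this
      simp only [Set.mem_iUnion] at this ⊢
      obtain ⟨x, hx, hxy⟩ := this
      exact ⟨x, hx, Metric.ball_subset_closedBall hxy⟩
    · exact Set.iUnion₂_subset fun x _ => hrU x x.2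
  rw [hU', Set.preimage_iUnion₂]
  exact MeasurableSet.biUnion hC fun x _ => hball _ _ (hr x x.2).le

/-- `X_ε` as a random element of `C([0,S] × [0,T]; ℂ)`, for `ε > 0` and a jointly measurable `L`. -/
def levyPath {Ω : Type*} [MeasurableSpace Ω] {L : ℝ≥0 → ℝ≥0 → Ω → ℝ}
    (hL : Measurable fun p : (ℝ≥0 × ℝ≥0) × Ω => L p.1.1 p.1.2 p.2) (Ψ : ℝ → ℂ) (θ S T : ℝ)
    {ε : ℝ} (hε : 0 < ε) (ω : Ω) : PathSpace S T :=
  ⟨fun z => levyField L Ψ θ ε z.1 z.2 ω, continuous_levyField hL Ψ θ hε S T ω⟩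

theorem measurable_levyPath {Ω : Type*} [MeasurableSpace Ω] {L : ℝ≥0 → ℝ≥0 → Ω → ℝ}
    (hL : Measurable fun p : (ℝ≥0 × ℝ≥0) × Ω => L p.1.1 p.1.2 p.2) (Ψ : ℝ → ℂ) (θ S T : ℝ)
    {ε : ℝ} (hε : 0 < ε) : Measurable (levyPath hL Ψ θ S T hε) :=
  measurable_pathSpace_of_eval fun z => measurable_levyField hL Ψ θ hε z.1.2.1 z.2.2.1

/-- The law `P_ε` of `X_ε` in `C([0,S] × [0,T]; ℂ)`. -/
def levyLaw {Ω : Type*} [MeasurableSpace Ω] (μ : ProbabilityMeasure Ω) {L : ℝ≥0 → ℝ≥0 → Ω → ℝ}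
    (hL : Measurable fun p : (ℝ≥0 × ℝ≥0) × Ω => L p.1.1 p.1.2 p.2) (Ψ : ℝ → ℂ) (θ S T : ℝ)
    {ε : ℝ} (hε : 0 < ε) : ProbabilityMeasure (PathSpace S T) :=
  μ.map (measurable_levyPath hL Ψ θ S T hε).aemeasurable

/-! ## Two-parameter filtrations and strong martingales -/

/-- The right end point `R` of the interval `[0,R]` containing `u`. -/
def rightEnd {R : ℝ} (u : Set.Icc (0 : ℝ) R) : Set.Icc (0 : ℝ) R :=
  ⟨R, u.2.1.trans u.2.2, le_rfl⟩

/-- The canonical process `X(s,t)` on the path space. -/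
def canonicalProcess {S T : ℝ} (z : ParamRect S T) (w : PathSpace S T) : ℂ := w z

theorem stronglyMeasurable_canonicalProcess {S T : ℝ} (z : ParamRect S T) :
    StronglyMeasurable (canonicalProcess (S := S) (T := T) z) :=
  (by unfold canonicalProcess; fun_prop : Continuous (canonicalProcess (S := S) (T := T) z)).stronglyMeasurable

/-- The natural filtration `F_{s,t} = σ(X(u,v); u ≤ s, v ≤ t)` of the canonical process. -/
def canonicalFiltration (S T : ℝ) :
    Filtration (ParamRect S T) (pathSpaceMeasurableSpace S T) :=
  Filtration.natural canonicalProcess stronglyMeasurable_canonicalProcess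

/-- The augmentation of a two-parameter filtration: add all null sets to every σ-algebra, then
make the filtration right-continuous, `F⁺_z = ⋂_{z < z'} F_{z'}`. At the upper boundary, where no
`z'` is strictly larger in a coordinate, that coordinate is kept at its end point. -/
def augmentedFiltration {S T : ℝ} {E : Type*} {m : MeasurableSpace E} (P : Measure E)
    (F : Filtration (ParamRect S T) m) : Filtration (ParamRect S T) m where
  seq z := ⨅ (w : ParamRect S T)
    (_ : (z.1 < w.1 ∨ w.1 = rightEnd z.1) ∧ (z.2 < w.2 ∨ w.2 = rightEnd z.2)),
      F w ⊔ MeasurableSpace.generateFrom {A : Set E | MeasurableSet[m] A ∧ P A = 0}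
  mono' := by
    intro z z' hzz'
    refine le_iInf₂ fun w hw => iInf₂_le w ⟨?_, ?_⟩
    · exact hw.1.imp (fun h => lt_of_le_of_lt hzz'.1 h) fun h => h
    · exact hw.2.imp (fun h => lt_of_le_of_lt hzz'.2 h) fun h => h
  le' z := (iInf₂_le (rightEnd z.1, rightEnd z.2) ⟨Or.inr rfl, Or.inr rfl⟩).trans
    (sup_le (F.le _) (MeasurableSpace.generateFrom_le fun _ hA => hA.1))

/-- The increment `Δ_{s,t} Y(s',t')`. -/
def rectIncrement {S T : ℝ} {E : Type*} (Y : ParamRect S T → E → ℝ)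
    (s s' : Set.Icc (0 : ℝ) S) (t t' : Set.Icc (0 : ℝ) T) (ω : E) : ℝ :=
  Y (s', t') ω - Y (s, t') ω - Y (s', t) ω + Y (s, t) ω

/-- Strong martingales on `[0,S] × [0,T]` with respect to a two-parameter filtration. -/
structure IsStrongMartingale {S T : ℝ} {E : Type*} {m : MeasurableSpace E}
    (Y : ParamRect S T → E → ℝ) (F : Filtration (ParamRect S T) m) (P : Measure E) : Prop where
  adapted : ∀ z, Measurable[F z] (Y z)
  integrable : ∀ z, Integrable (Y z) P
  /-- `Y(s,0) = Y(0,t) = 0` for all `s, t`, almost surely -/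
  zero_on_axes : ∀ᵐ ω ∂P, ∀ z : ParamRect S T, (z.1 : ℝ) = 0 ∨ (z.2 : ℝ) = 0 → Y z ω = 0
  /-- `E[Δ_{s,t} Y(s',t') | F_{S,t} ∨ F_{s,T}] = 0` for all `(s,t) < (s',t')` -/
  condExp_increment : ∀ s s' : Set.Icc (0 : ℝ) S, ∀ t t' : Set.Icc (0 : ℝ) T, s < s' → t < t' →
    P[rectIncrement Y s s' t t' | F (rightEnd s, t) ⊔ F (s, rightEnd t)] =ᵐ[P] 0

end

/-! Over a rectangle of area λ the characteristic function of the increment at θ has modulus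
exp(-aλ), where a is the real part of Ψ(θ). It is at most 1, so a ≥ 0, and hence a > 0. This
exponential decay drives every estimate.

The core is asymptotic orthogonality of an increment of X_ε over (s,s'] × (t,t'], with s, t > 0, to
everything left of s or below t. On the unscaled sheet, L(x,y) is the sum of the past quantity
L(s,y) + L(x,t) - L(s,t) and the increment over (s,x] × (t,y], which is independent of the past
(`indepFun_increment_past`). Conditioning therefore replaces the integrand by `levyIntegrandPast`,
which carries a damping factor exp(-a(x-s)(y-t)) (`integral_past_mul_levyIntegrand`). By
Cauchy–Schwarz it is enough to bound the second moment of the integral of this conditioned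
integrand. Its correlations decay exponentially in s|y-y'| and t|x-x'| (`norm_char_cross`), and
after rescaling the bound is O(ε) (`enorm_integral_past_mul_increment_sq_le`). The same correlation
method without conditioning bounds the second moment of X_ε uniformly in ε
(`lintegral_enorm_levyField_sq_le`).

These L² bounds allow truncation, so vanishing expectations pass to the weak limit against products
of bounded continuous functions of past values (`integral_mul_eq_zero_of_tendsto`). Indicators of
closed sets are limits of such functions, and a π-λ argument reaches the whole past σ-algebra
(`setIntegral_eq_zero_of_closedCylinders`).

Finally the lower-left corner of the rectangle is approached from strictly inside. Path continuity
and the L² bound give the limit (`setIntegral_eq_zero_of_tendsto`). This one step covers corners on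
the axes, where the O(ε) constant blows up, as well as the right-continuous augmentation, whose
σ-algebras lie, up to null sets, in the natural ones at any strictly later corner. -/

/-! ### Characteristic functions and independence of increments -/

namespace IsLevySheet

variable {Ω : Type*} [MeasurableSpace Ω] {L : ℝ≥0 → ℝ≥0 → Ω → ℝ} {Ψ : ℝ → ℂ} {μ : Measure Ω}

theorem norm_char_increment (hL : IsLevySheet L Ψ μ) (Q : QuadrantRect) (ξ : ℝ) :
    ‖∫ ω, Complex.exp (Complex.I * ((ξ * Q.increment L ω : ℝ) : ℂ)) ∂μ‖
      = Real.exp (-(Ψ ξ).re * Q.area) := by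
  rw [hL.char_increment, Complex.norm_exp]
  congr 1
  simp [Complex.mul_re]
  ring

/-- A characteristic function has modulus at most 1; the unit square turns this into exp(-Re Ψ(ξ)) ≤
1. -/
theorem re_exponent_nonneg [IsProbabilityMeasure μ] (hL : IsLevySheet L Ψ μ) (ξ : ℝ) :
    0 ≤ (Ψ ξ).re := by
  have h := hL.norm_char_increment ⟨0, 1, 0, 1, zero_lt_one, zero_lt_one⟩ ξ
  have h1 : ‖∫ ω, Complex.exp (Complex.I * ((ξ * QuadrantRect.increment
      ⟨0, 1, 0, 1, zero_lt_one, zero_lt_one⟩ L ω : ℝ) : ℂ)) ∂μ‖ ≤ 1 := by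
    refine (norm_integral_le_of_norm_le_const (C := 1) (ae_of_all _ fun ω => ?_)).trans (by simp)
    rw [mul_comm, Complex.norm_exp_ofReal_mul_I]
  rw [h, Real.exp_le_one_iff] at h1
  simp only [QuadrantRect.area] at h1
  norm_num at h1
  exact h1

theorem norm_char_neg_increment (hL : IsLevySheet L Ψ μ) (Q : QuadrantRect) (ξ : ℝ) :
    ‖∫ ω, Complex.exp (Complex.I * ((-ξ * Q.increment L ω : ℝ) : ℂ)) ∂μ‖
      = Real.exp (-(Ψ ξ).re * Q.area) := by
  rw [← hL.norm_char_increment Q ξ, ← RCLike.norm_conj (∫ ω, _ ∂μ), ← integral_conj]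
  congr 2 with ω
  rw [← Complex.exp_conj]
  simp

/-- Independence of a family is a condition on its finite subfamilies, so the `Fin n` version in the
definition of a Lévy sheet suffices. -/
theorem iIndepFun_increment (hL : IsLevySheet L Ψ μ) {ι : Type*} (Q : ι → QuadrantRect)
    (hQ : Pairwise fun i j => Disjoint (Q i).toSet (Q j).toSet) :
    iIndepFun (fun i => (Q i).increment L) μ := by
  rw [iIndepFun_iff_finset]
  intro F
  let e := F.equivFin
  have h := hL.indep_increments _ (fun i => Q (e.symm i)) fun i j hij =>
    hQ fun h => hij (e.symm.injective (Subtype.ext h))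
  have h2 := h.precomp (g := e) e.injective
  simpa [Finset.restrict_def] using h2

end IsLevySheet

/-! ### Grids and independence of an increment from the past -/

/-- The cells of the grid with coordinates `a` and `b`. -/
def gridCell {a b : ℕ → ℝ≥0} (ha : StrictMono a) (hb : StrictMono b) (i : ℕ × ℕ) : QuadrantRect :=
  ⟨a i.1, a (i.1 + 1), b i.2, b (i.2 + 1), ha i.1.lt_succ_self, hb i.2.lt_succ_self⟩

theorem StrictMono.eq_of_mem_Ioc {a : ℕ → ℝ≥0} (ha : StrictMono a) {i j : ℕ} {x : ℝ≥0}
    (hi : x ∈ Set.Ioc (a i) (a (i + 1))) (hj : x ∈ Set.Ioc (a j) (a (j + 1))) : i = j := by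
  have h1 := ha.lt_iff_lt.1 (hi.1.trans_le hj.2)
  have h2 := ha.lt_iff_lt.1 (hj.1.trans_le hi.2)
  omega

theorem pairwise_disjoint_gridCell {a b : ℕ → ℝ≥0} (ha : StrictMono a) (hb : StrictMono b) :
    Pairwise fun i j => Disjoint (gridCell ha hb i).toSet (gridCell ha hb j).toSet := by
  intro i j hij
  rw [Set.disjoint_left]
  rintro ⟨x, y⟩ hi hj
  exact hij (Prod.ext (ha.eq_of_mem_Ioc hi.1 hj.1) (hb.eq_of_mem_Ioc hi.2 hj.2))

theorem sum_gridCell_increment {Ω : Type*} (L : ℝ≥0 → ℝ≥0 → Ω → ℝ) {a b : ℕ → ℝ≥0}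
    (ha : StrictMono a) (hb : StrictMono b) {k k' l l' : ℕ} (hk : k ≤ k') (hl : l ≤ l') (ω : Ω) :
    ∑ i ∈ Finset.Ico k k' ×ˢ Finset.Ico l l', (gridCell ha hb i).increment L ω =
      L (a k') (b l') ω - L (a k) (b l') ω - L (a k') (b l) ω + L (a k) (b l) ω := by
  have key : ∀ (f : ℕ → ℝ) {m n : ℕ}, m ≤ n →
      ∑ i ∈ Finset.Ico m n, (f (i + 1) - f i) = f n - f m := fun f m n h => by
    rw [Finset.sum_Ico_eq_sub _ h, Finset.sum_range_sub, Finset.sum_range_sub]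
    ring
  rw [Finset.sum_product]
  have h1 : ∀ i, ∑ j ∈ Finset.Ico l l', (gridCell ha hb (i, j)).increment L ω =
      (L (a (i + 1)) (b l') ω - L (a (i + 1)) (b l) ω) - (L (a i) (b l') ω - L (a i) (b l) ω) := by
    intro i
    have h := key (fun j => L (a (i + 1)) (b j) ω - L (a i) (b j) ω) hl
    rw [show (L (a (i + 1)) (b l') ω - L (a (i + 1)) (b l) ω) -
      (L (a i) (b l') ω - L (a i) (b l) ω) = (L (a (i + 1)) (b l') ω - L (a i) (b l') ω) -
      (L (a (i + 1)) (b l) ω - L (a i) (b l) ω) by ring, ← h]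
    refine Finset.sum_congr rfl fun j _ => ?_
    simp only [QuadrantRect.increment, gridCell]
    ring
  simp_rw [h1]
  rw [key (fun i => L (a i) (b l') ω - L (a i) (b l) ω) hk]
  ring

/-- Enumerate the finite set together with 0 and continue beyond its maximum. Infinite coordinate
sequences make every index legitimate, and starting at 0 places the lower edges of the grid on the
axes. -/
theorem exists_strictMono_subset_range (A : Finset ℝ≥0) :
    ∃ a : ℕ → ℝ≥0, StrictMono a ∧ a 0 = 0 ∧ (A : Set ℝ≥0) ⊆ Set.range a := by
  classical
  set B := insert 0 A with hB
  have hpos : 0 < B.card := Finset.card_pos.2 ⟨0, Finset.mem_insert_self _ _⟩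
  set f := B.orderEmbOfFin rfl with hf
  set M := B.sup id with hM
  have hle : ∀ i, f i ≤ M := fun i => Finset.le_sup (f := id) (B.orderEmbOfFin_mem rfl i)
  refine ⟨fun i => if h : i < B.card then f ⟨i, h⟩ else M + (i + 1), ?_, ?_, ?_⟩
  · intro i j hij
    by_cases hj : j < B.card
    · have hi := hij.trans hj
      simp only [hi, hj, dif_pos]
      exact f.strictMono hij
    · by_cases hi : i < B.card
      · simp only [hi, hj, dif_pos, dif_neg, not_false_iff]
        refine (hle _).trans_lt ?_
        exact lt_add_of_pos_right _ (by positivity)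
      · simp only [hi, hj, dif_neg, not_false_iff]
        gcongr
  · simp only [hpos, dif_pos]
    rw [hf, Finset.orderEmbOfFin_zero rfl hpos]
    exact le_antisymm (Finset.min'_le _ _ (Finset.mem_insert_self _ _)) bot_le
  · intro x hx
    have : x ∈ Set.range f := by
      rw [hf, Finset.range_orderEmbOfFin]
      exact Finset.mem_insert_of_mem hx
    obtain ⟨i, rfl⟩ := this
    exact ⟨i, by simp⟩

namespace IsLevySheet

variable {Ω : Type*} [MeasurableSpace Ω] {L : ℝ≥0 → ℝ≥0 → Ω → ℝ} {Ψ : ℝ → ℂ} {μ : Measure Ω}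

/-- The double sum telescopes to the increment over a rectangle touching both axes, where the sheet
vanishes almost surely. Each value of the sheet is thereby built from increments over disjoint
cells. -/
theorem ae_eq_sum_gridCell (hL : IsLevySheet L Ψ μ) {a b : ℕ → ℝ≥0}
    (ha : StrictMono a) (hb : StrictMono b) (ha0 : a 0 = 0) (hb0 : b 0 = 0) (k l : ℕ) :
    (fun ω => ∑ i ∈ Finset.Ico 0 k ×ˢ Finset.Ico 0 l, (gridCell ha hb i).increment L ω)
      =ᵐ[μ] L (a k) (b l) := by
  filter_upwards [hL.zero_left (b l), hL.zero_right (a k), hL.zero_left 0] with ω h1 h2 h3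
  rw [sum_gridCell_increment L ha hb (Nat.zero_le _) (Nat.zero_le _), ha0, hb0, h1, h2, h3]
  ring

/-- The increment over `Q` is independent of the values of the sheet to the left of or below `Q`. -/
theorem indepFun_increment_past [IsProbabilityMeasure μ] (hL : IsLevySheet L Ψ μ)
    (hm : ∀ x y, Measurable (L x y)) (Q : QuadrantRect) :
    IndepFun (Q.increment L)
      (fun ω (z : {z : ℝ≥0 × ℝ≥0 // z.1 ≤ Q.s ∨ z.2 ≤ Q.t}) => L z.1.1 z.1.2 ω) μ := by
  classical
  have hQm : ∀ Q : QuadrantRect, Measurable (Q.increment L) := fun Q =>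
    (((hm _ _).sub (hm _ _)).sub (hm _ _)).add (hm _ _)
  refine IndepFun.indepFun_process (hQm Q) (fun z => hm _ _) fun I => ?_
  -- It suffices to treat finitely many past points. A common grid through their coordinates and
  -- those of `Q` expresses everything by independent cell increments.
  obtain ⟨a, ha, ha0, haI⟩ := exists_strictMono_subset_range
    ({Q.s, Q.s'} ∪ I.image fun z => z.1.1)
  obtain ⟨b, hb, hb0, hbI⟩ := exists_strictMono_subset_range
    ({Q.t, Q.t'} ∪ I.image fun z => z.1.2)
  obtain ⟨k, hk⟩ := haI (show Q.s ∈ _ by simp)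
  obtain ⟨k', hk'⟩ := haI (show Q.s' ∈ _ by simp)
  obtain ⟨l, hl⟩ := hbI (show Q.t ∈ _ by simp)
  obtain ⟨l', hl'⟩ := hbI (show Q.t' ∈ _ by simp)
  have hza : ∀ z : I, ∃ i, a i = z.1.1.1 := fun z =>
    haI (Finset.mem_coe.2 (Finset.mem_union_right _ (Finset.mem_image_of_mem _ z.2)))
  have hzb : ∀ z : I, ∃ i, b i = z.1.1.2 := fun z =>
    hbI (Finset.mem_coe.2 (Finset.mem_union_right _ (Finset.mem_image_of_mem _ z.2)))
  choose i hi using hza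
  choose j hj using hzb
  have hkk : k ≤ k' := ha.le_iff_le.1 (by rw [hk, hk']; exact Q.hs.le)
  have hll : l ≤ l' := hb.le_iff_le.1 (by rw [hl, hl']; exact Q.ht.le)
  set A : Finset (ℕ × ℕ) := Finset.Ico k k' ×ˢ Finset.Ico l l' with hA
  set B : Finset (ℕ × ℕ) :=
    Finset.univ.biUnion fun z : I => Finset.Ico 0 (i z) ×ˢ Finset.Ico 0 (j z) with hB
  -- `A` holds the cells of `Q`, and `B` those below and to the left of some past point. Such a
  -- point has abscissa at most `Q.s` or ordinate at most `Q.t`, so no cell is shared.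
  have hAB : Disjoint A B := by
    rw [Finset.disjoint_left]
    rintro ⟨p, q⟩ hp hq
    simp only [hA, hB, Finset.mem_product, Finset.mem_Ico, Finset.mem_biUnion, Finset.mem_univ,
      true_and, zero_le] at hp hq
    obtain ⟨z, hz1, hz2⟩ := hq
    rcases z.1.2 with h | h
    · rw [← hi, ← hk, ha.le_iff_le] at h
      omega
    · rw [← hj, ← hl, hb.le_iff_le] at h
      omega
  have hind := (hL.iIndepFun_increment _ (pairwise_disjoint_gridCell ha hb)).indepFun_finset A B hAB
    fun p => hQm _
  have hBz : ∀ z : I, Finset.Ico 0 (i z) ×ˢ Finset.Ico 0 (j z) ⊆ B := fun z =>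
    Finset.subset_biUnion_of_mem (fun z : I => Finset.Ico 0 (i z) ×ˢ Finset.Ico 0 (j z))
      (Finset.mem_univ z)
  have hcomp := hind.comp (φ := fun f : A → ℝ => ∑ p, f p)
    (ψ := fun (f : B → ℝ) (z : I) => ∑ p : (Finset.Ico 0 (i z) ×ˢ Finset.Ico 0 (j z) :
      Finset (ℕ × ℕ)), f ⟨p.1, hBz z p.2⟩) (by fun_prop) (by fun_prop)
  have h1 : (fun f : A → ℝ => ∑ p, f p) ∘ (fun ω (p : A) => (gridCell ha hb p).increment L ω)
      = Q.increment L := by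
    funext ω
    simp only [Function.comp]
    rw [Finset.sum_coe_sort A fun p => (gridCell ha hb p).increment L ω,
      sum_gridCell_increment L ha hb hkk hll, hk, hk', hl, hl']
    rfl
  rw [h1] at hcomp
  refine IndepFun.process_congr_right
    (X := fun (z : I) ω => ∑ p ∈ Finset.Ico 0 (i z) ×ˢ Finset.Ico 0 (j z),
      (gridCell ha hb p).increment L ω) ?_ fun z => ?_
  · convert hcomp using 3 with ω z
    simp only [Function.comp]
    exact (Finset.sum_coe_sort _ fun p => (gridCell ha hb p).increment L ω).symm
  · have := hL.ae_eq_sum_gridCell ha hb ha0 hb0 (i z) (j z)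
    rwa [hi, hj] at this

/-- The difference is, up to sign, the increment over the strip between heights y and y' reaching
back to the vertical axis. The first alternative absorbs an empty strip, which is not a
`QuadrantRect`. -/
theorem strip_left (hL : IsLevySheet L Ψ μ) (u y y' : ℝ≥0) :
    ((fun ω => L u y ω - L u y' ω) =ᵐ[μ] 0 ∧ (u : ℝ) * |(y : ℝ) - y'| = 0) ∨
      ∃ (Q : QuadrantRect) (c : ℝ), (c = 1 ∨ c = -1) ∧ Q.area = u * |(y : ℝ) - y'| ∧ Q.s' = u ∧
        (fun ω => L u y ω - L u y' ω) =ᵐ[μ] fun ω => c * Q.increment L ω := by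
  rcases (zero_le (a := u)).eq_or_lt with rfl | hu
  · refine Or.inl ⟨?_, by simp⟩
    filter_upwards [hL.zero_left y, hL.zero_left y'] with ω h1 h2
    simp [h1, h2]
  rcases lt_trichotomy y y' with h | rfl | h
  · refine Or.inr ⟨⟨0, u, y, y', hu, h⟩, -1, Or.inr rfl, ?_, rfl, ?_⟩
    · rw [abs_sub_comm, abs_of_nonneg (sub_nonneg.2 (NNReal.coe_le_coe.2 h.le))]
      simp [QuadrantRect.area]
    · filter_upwards [hL.zero_left y, hL.zero_left y'] with ω h1 h2
      simp [QuadrantRect.increment, h1, h2]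
  · exact Or.inl ⟨by simp; rfl, by simp⟩
  · refine Or.inr ⟨⟨0, u, y', y, hu, h⟩, 1, Or.inl rfl, ?_, rfl, ?_⟩
    · rw [abs_of_nonneg (sub_nonneg.2 (NNReal.coe_le_coe.2 h.le))]
      simp [QuadrantRect.area]
    · filter_upwards [hL.zero_left y, hL.zero_left y'] with ω h1 h2
      simp [QuadrantRect.increment, h1, h2]

theorem strip_below (hL : IsLevySheet L Ψ μ) (x x' v : ℝ≥0) :
    ((fun ω => L x v ω - L x' v ω) =ᵐ[μ] 0 ∧ (v : ℝ) * |(x : ℝ) - x'| = 0) ∨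
      ∃ (Q : QuadrantRect) (c : ℝ), (c = 1 ∨ c = -1) ∧ Q.area = v * |(x : ℝ) - x'| ∧
        Q.s = min x x' ∧
        (fun ω => L x v ω - L x' v ω) =ᵐ[μ] fun ω => c * Q.increment L ω := by
  rcases (zero_le (a := v)).eq_or_lt with rfl | hv
  · refine Or.inl ⟨?_, by simp⟩
    filter_upwards [hL.zero_right x, hL.zero_right x'] with ω h1 h2
    simp [h1, h2]
  rcases lt_trichotomy x x' with h | rfl | h
  · refine Or.inr ⟨⟨x, x', 0, v, h, hv⟩, -1, Or.inr rfl, ?_, (min_eq_left h.le).symm, ?_⟩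
    · rw [abs_sub_comm, abs_of_nonneg (sub_nonneg.2 (NNReal.coe_le_coe.2 h.le))]
      simp [QuadrantRect.area, mul_comm]
    · filter_upwards [hL.zero_right x, hL.zero_right x'] with ω h1 h2
      simp [QuadrantRect.increment, h1, h2]
  · exact Or.inl ⟨by simp; rfl, by simp⟩
  · refine Or.inr ⟨⟨x', x, 0, v, h, hv⟩, 1, Or.inl rfl, ?_, (min_eq_right h.le).symm, ?_⟩
    · rw [abs_of_nonneg (sub_nonneg.2 (NNReal.coe_le_coe.2 h.le))]
      simp [QuadrantRect.area, mul_comm]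
    · filter_upwards [hL.zero_right x, hL.zero_right x'] with ω h1 h2
      simp [QuadrantRect.increment, h1, h2]

theorem norm_char_signed_increment (hL : IsLevySheet L Ψ μ) (Q : QuadrantRect) (ξ : ℝ) {c : ℝ}
    (hc : c = 1 ∨ c = -1) :
    ‖∫ ω, Complex.exp (Complex.I * ((ξ * (c * Q.increment L ω) : ℝ) : ℂ)) ∂μ‖
      = Real.exp (-(Ψ ξ).re * Q.area) := by
  rcases hc with rfl | rfl
  · simpa using hL.norm_char_increment Q ξ
  · simpa using hL.norm_char_neg_increment Q ξ

/-- The characteristic function of the increments of the sheet over a cross made of a horizontal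
strip of width `u` and a vertical strip of height `v`. -/
theorem norm_char_cross [IsProbabilityMeasure μ] (hL : IsLevySheet L Ψ μ)
    (hm : ∀ x y, Measurable (L x y)) (ξ : ℝ) {u x x' : ℝ≥0} (y y' v : ℝ≥0)
    (hx : u ≤ x) (hx' : u ≤ x') :
    ‖∫ ω, Complex.exp (Complex.I * ((ξ * ((L u y ω - L u y' ω) + (L x v ω - L x' v ω)) : ℝ) : ℂ)) ∂μ‖
      = Real.exp (-(Ψ ξ).re * (u * |(y : ℝ) - y'| + v * |(x : ℝ) - x'|)) := by
  have hQm : ∀ Q : QuadrantRect, Measurable (Q.increment L) := fun Q =>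
    (((hm _ _).sub (hm _ _)).sub (hm _ _)).add (hm _ _)
  rcases hL.strip_left u y y' with ⟨h1, e1⟩ | ⟨Q, c, hc, e1, hQ, h1⟩ <;>
  rcases hL.strip_below x x' v with ⟨h2, e2⟩ | ⟨Q', c', hc', e2, hQ', h2⟩
  · rw [e1, e2, integral_congr_ae (g := fun _ => 1)]
    · simp
    · filter_upwards [h1, h2] with ω h1 h2
      simp only [h1, h2]
      simp
  · rw [e1, ← e2, zero_add, ← hL.norm_char_signed_increment Q' ξ hc']
    congr 1
    refine integral_congr_ae ?_
    filter_upwards [h1, h2] with ω h1 h2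
    simp only [h1, h2]
    simp
  · rw [e2, ← e1, add_zero, ← hL.norm_char_signed_increment Q ξ hc]
    congr 1
    refine integral_congr_ae ?_
    filter_upwards [h1, h2] with ω h1 h2
    simp only [h1, h2]
    simp
  · rw [← e1, ← e2, mul_add, Real.exp_add, ← hL.norm_char_signed_increment Q ξ hc,
      ← hL.norm_char_signed_increment Q' ξ hc', ← norm_mul]
    -- One strip ends at abscissa u and the other starts at min x x' ≥ u. Being disjoint, they carry
    -- independent increments, and the characteristic function factorizes.
    have hdis : Disjoint Q.toSet Q'.toSet := by
      rw [Set.disjoint_left]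
      rintro ⟨p, q⟩ hp hq
      have h3 : p ≤ u := hQ ▸ hp.1.2
      have h4 : min x x' < p := hQ' ▸ hq.1.1
      exact absurd (h4.trans_le h3) (not_lt.2 (le_min hx hx'))
    have hind : IndepFun (Q.increment L) (Q'.increment L) μ := by
      have := (hL.iIndepFun_increment ![Q, Q'] (by
        intro i j hij
        fin_cases i <;> fin_cases j <;> simp_all [disjoint_comm])).indepFun
        (i := 0) (j := 1) (by simp)
      simpa using this
    have hind' := hind.comp
      (φ := fun r : ℝ => Complex.exp (Complex.I * ((ξ * (c * r) : ℝ) : ℂ)))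
      (ψ := fun r : ℝ => Complex.exp (Complex.I * ((ξ * (c' * r) : ℝ) : ℂ)))
      (by fun_prop) (by fun_prop)
    have hmul := hind'.integral_mul_eq_mul_integral
      (Measurable.aestronglyMeasurable (by have := hQm Q; fun_prop))
      (Measurable.aestronglyMeasurable (by have := hQm Q'; fun_prop))
    simp only [Function.comp_def, Pi.mul_apply] at hmul
    rw [← hmul]
    congr 1
    refine integral_congr_ae ?_
    filter_upwards [h1, h2] with ω h1 h2
    simp only [h1, h2]
    rw [← Complex.exp_add]
    push_cast
    ring_nf

end IsLevySheet

/-! ### Integrals of random fields: second moments and measurability -/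

section RandomIntegral

variable {Ω Z : Type*} [MeasurableSpace Ω] [MeasurableSpace Z] {μ : Measure Ω}
  [IsProbabilityMeasure μ] {ν : Measure Z} [SFinite ν]

/-- The second moment of a random integral, in terms of its correlation kernel. -/
theorem lintegral_enorm_integral_sq_le {f : Z → Ω → ℂ} (hf : Measurable (Function.uncurry f))
    {G : Z → ℝ} (hG : Integrable G ν) (hfG : ∀ᵐ z ∂ν, ∀ ω, ‖f z ω‖ ≤ G z)
    {κ : Z → Z → ENNReal}
    (hκ : ∀ᵐ z ∂ν, ∀ᵐ z' ∂ν, ‖∫ ω, f z ω * (starRingEnd ℂ) (f z' ω) ∂μ‖ₑ ≤ κ z z') :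
    ∫⁻ ω, ‖∫ z, f z ω ∂ν‖ₑ ^ 2 ∂μ ≤ ∫⁻ z, ∫⁻ z', κ z z' ∂ν ∂ν := by
  have hm : Measurable fun p : Ω × (Z × Z) => f p.2.1 p.1 * (starRingEnd ℂ) (f p.2.2 p.1) := by
    have h1 : Measurable fun p : Ω × (Z × Z) => f p.2.1 p.1 :=
      hf.comp (f := fun p : Ω × (Z × Z) => (p.2.1, p.1)) (by fun_prop)
    have h2 : Measurable fun p : Ω × (Z × Z) => f p.2.2 p.1 :=
      hf.comp (f := fun p : Ω × (Z × Z) => (p.2.2, p.1)) (by fun_prop)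
    exact h1.mul (Complex.continuous_conj.measurable.comp h2)
  have hGG : Integrable (fun p : Ω × (Z × Z) => G p.2.1 * G p.2.2) (μ.prod (ν.prod ν)) :=
    (hG.mul_prod hG).comp_snd μ
  have hint : Integrable (fun p : Ω × (Z × Z) => f p.2.1 p.1 * (starRingEnd ℂ) (f p.2.2 p.1))
      (μ.prod (ν.prod ν)) := by
    refine hGG.mono' hm.aestronglyMeasurable ?_
    have h1 : ∀ᵐ q ∂ν.prod ν, ∀ ω, ‖f q.1 ω‖ ≤ G q.1 := Measure.quasiMeasurePreserving_fst.ae hfG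
    have h2 : ∀ᵐ q ∂ν.prod ν, ∀ ω, ‖f q.2 ω‖ ≤ G q.2 := Measure.quasiMeasurePreserving_snd.ae hfG
    filter_upwards [Measure.quasiMeasurePreserving_snd.ae (h1.and h2)] with p hp
    rw [norm_mul, RCLike.norm_conj]
    exact mul_le_mul (hp.1 _) (hp.2 _) (norm_nonneg _) ((norm_nonneg _).trans (hp.1 p.1))
  -- The squared modulus of an integral is a double integral, after which Fubini brings the
  -- expectation inside.
  have hsq : ∀ ω, ∫ q, f q.1 ω * (starRingEnd ℂ) (f q.2 ω) ∂ν.prod ν =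
      ((‖∫ z, f z ω ∂ν‖ ^ 2 : ℝ) : ℂ) := fun ω => by
    rw [integral_prod_mul (fun z => f z ω) (fun z => (starRingEnd ℂ) (f z ω)), integral_conj,
      RCLike.mul_conj]
    simp
  have hint2 : Integrable (fun ω => ((‖∫ z, f z ω ∂ν‖ ^ 2 : ℝ) : ℂ)) μ := by
    simpa only [hsq] using hint.integral_prod_left
  calc ∫⁻ ω, ‖∫ z, f z ω ∂ν‖ₑ ^ 2 ∂μ
      = ∫⁻ ω, ENNReal.ofReal (‖∫ z, f z ω ∂ν‖ ^ 2) ∂μ := by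
        simp_rw [ENNReal.ofReal_pow (norm_nonneg _), ofReal_norm]
    _ = ENNReal.ofReal (∫ ω, ‖∫ z, f z ω ∂ν‖ ^ 2 ∂μ) := by
        rw [ofReal_integral_eq_lintegral_ofReal _ (ae_of_all _ fun ω => by positivity)]
        exact hint2.re
    _ ≤ ‖∫ ω, ((‖∫ z, f z ω ∂ν‖ ^ 2 : ℝ) : ℂ) ∂μ‖ₑ := by
        rw [integral_complex_ofReal, ← ofReal_norm, Complex.norm_real]
        exact ENNReal.ofReal_le_ofReal (Real.le_norm_self _)
    _ = ‖∫ q, ∫ ω, f q.1 ω * (starRingEnd ℂ) (f q.2 ω) ∂μ ∂ν.prod ν‖ₑ := by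
        simp_rw [← hsq]
        rw [integral_integral_swap hint]
    _ ≤ ∫⁻ q, ‖∫ ω, f q.1 ω * (starRingEnd ℂ) (f q.2 ω) ∂μ‖ₑ ∂ν.prod ν :=
        enorm_integral_le_lintegral_enorm _
    _ ≤ ∫⁻ z, ∫⁻ z', ‖∫ ω, f z ω * (starRingEnd ℂ) (f z' ω) ∂μ‖ₑ ∂ν ∂ν := lintegral_prod_le _
    _ ≤ ∫⁻ z, ∫⁻ z', κ z z' ∂ν ∂ν := lintegral_mono_ae (hκ.mono fun z hz => lintegral_mono_ae hz)

/-- A random integral whose integrand is measurable with respect to a sub-σ-algebra for each value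
of the parameter, but jointly measurable only with respect to the whole σ-algebra, is almost
everywhere measurable with respect to the sub-σ-algebra. -/
theorem aestronglyMeasurable_integral_of_forall {Ω Z : Type*} {m m0 : MeasurableSpace Ω}
    [MeasurableSpace Z] {μ : Measure Ω} [IsProbabilityMeasure μ] {ν : Measure Z} [SFinite ν]
    (hm : m ≤ m0) {f : Z → Ω → ℝ} (hf : Measurable (Function.uncurry f))
    {G : Z → ℝ} (hG : Integrable G ν) (hfG : ∀ᵐ z ∂ν, ∀ ω, |f z ω| ≤ G z)
    (hfm : ∀ᵐ z ∂ν, StronglyMeasurable[m] (f z)) :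
    AEStronglyMeasurable[m] (fun ω => ∫ z, f z ω ∂ν) μ := by
  set X : Ω → ℝ := fun ω => ∫ z, f z ω ∂ν with hX
  set C : ℝ≥0 := ⟨∫ z, |G z| ∂ν, integral_nonneg fun z => abs_nonneg _⟩ with hC
  have hf' : Measurable fun p : Ω × Z => f p.2 p.1 := hf.comp measurable_swap
  have hXm : StronglyMeasurable X := hf'.stronglyMeasurable.integral_prod_right'
  have hXb : ∀ ω, |X ω| ≤ C := fun ω => by
    rw [← Real.norm_eq_abs]
    refine norm_integral_le_of_norm_le hG.norm ?_
    filter_upwards [hfG] with z hz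
    exact (hz ω).trans (le_abs_self _)
  have hXi : Integrable X μ := Integrable.of_bound hXm.aestronglyMeasurable C (ae_of_all _ hXb)
  -- The aim is ∫ V² = 0, so that X agrees almost everywhere with its conditional expectation.
  set V : Ω → ℝ := X - μ[X | m] with hV
  have hEb : ∀ᵐ ω ∂μ, |(μ[X | m]) ω| ≤ C := ae_bdd_abs_condExp_of_ae_bdd_abs (ae_of_all _ hXb)
  have hVi : Integrable V μ := hXi.sub integrable_condExp
  have hVb : ∀ᵐ ω ∂μ, ‖V ω‖ ≤ 2 * C := by
    filter_upwards [hEb] with ω hω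
    have := norm_sub_le (X ω) ((μ[X | m]) ω)
    have h2 := hXb ω
    simp only [hV, Pi.sub_apply, Real.norm_eq_abs] at this ⊢
    linarith
  have hVE : μ[V | m] =ᵐ[μ] 0 := by
    have h1 := condExp_sub hXi (integrable_condExp (m := m) (f := X)) m
    rw [condExp_of_stronglyMeasurable hm stronglyMeasurable_condExp integrable_condExp] at h1
    filter_upwards [h1] with ω hω
    rw [hω]
    simp
  have horth : ∀ h : Ω → ℝ, StronglyMeasurable[m] h → ∀ c : ℝ, (∀ᵐ ω ∂μ, ‖h ω‖ ≤ c) →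
      ∫ ω, h ω * V ω ∂μ = 0 := by
    intro h hh c hc
    have hi : Integrable (h * V) μ := hVi.bdd_mul (hh.mono hm).aestronglyMeasurable hc
    have h1 := condExp_mul_of_stronglyMeasurable_left hh hi hVi
    have h2 : ∫ ω, (μ[h * V | m]) ω ∂μ = 0 := by
      refine integral_eq_zero_of_ae ?_
      filter_upwards [h1, hVE] with ω h1 h2
      rw [h1, Pi.mul_apply, h2]
      simp
    rwa [integral_condExp hm] at h2
  -- By Fubini, X may be replaced by the individual f z, which are measurable for the sub-σ-algebra
  -- and hence orthogonal to `V`.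
  have hXV : ∫ ω, X ω * V ω ∂μ = 0 := by
    have hint : Integrable (fun p : Ω × Z => f p.2 p.1 * V p.1) (μ.prod ν) := by
      refine ((integrable_const (2 * C : ℝ)).mul_prod hG (μ := μ)).mono'
        (hf'.aestronglyMeasurable.mul hVi.aestronglyMeasurable.comp_fst) ?_
      filter_upwards [Measure.quasiMeasurePreserving_fst.ae hVb,
        Measure.quasiMeasurePreserving_snd.ae hfG] with p h1 h2
      rw [norm_mul, mul_comm]
      exact mul_le_mul h1 (h2 p.1) (norm_nonneg _) ((norm_nonneg _).trans h1)
    simp_rw [hX, ← integral_mul_const]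
    rw [integral_integral_swap hint]
    refine integral_eq_zero_of_ae ?_
    filter_upwards [hfm, hfG] with z hz hz'
    exact horth _ hz (G z) (ae_of_all _ hz')
  have hEV : ∫ ω, (μ[X | m]) ω * V ω ∂μ = 0 := horth _ stronglyMeasurable_condExp C hEb
  have hVV : ∫ ω, V ω ^ 2 ∂μ = 0 := by
    have : ∀ ω, V ω ^ 2 = X ω * V ω - (μ[X | m]) ω * V ω := fun ω => by
      simp only [hV, Pi.sub_apply]; ring
    simp_rw [this]
    rw [integral_sub, hXV, hEV, sub_zero]
    · exact hVi.bdd_mul hXm.aestronglyMeasurable (ae_of_all _ hXb)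
    · exact hVi.bdd_mul (stronglyMeasurable_condExp.mono hm).aestronglyMeasurable hEb
  have hV0 : (fun ω => V ω ^ 2) =ᵐ[μ] 0 := by
    refine (integral_eq_zero_iff_of_nonneg (fun ω => sq_nonneg _) ?_).1 hVV
    simp_rw [sq]
    exact hVi.bdd_mul hVi.aestronglyMeasurable hVb
  refine ⟨μ[X | m], stronglyMeasurable_condExp, ?_⟩
  filter_upwards [hV0] with ω hω
  have : V ω = 0 := by simpa using hω
  simpa [hV, sub_eq_zero] using this

end RandomIntegral

/-! ### Integrals of the correlation kernels -/

section Kernels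

theorem lintegral_exp_neg_mul_abs {c : ℝ} (hc : 0 < c) :
    ∫⁻ x : ℝ, ENNReal.ofReal (Real.exp (-(c * |x|))) = ENNReal.ofReal (2 / c) := by
  have h : ∫ x : ℝ, Real.exp (-(c * |x|)) = 2 / c := by
    rw [integral_comp_abs (f := fun x => Real.exp (-(c * x)))]
    simp_rw [← neg_mul]
    rw [integral_exp_mul_Ioi (neg_lt_zero.2 hc)]
    simp
    ring
  -- The Bochner integral of a non-integrable function is 0, so the nonzero value just computed
  -- forces integrability.
  have hi : Integrable fun x : ℝ => Real.exp (-(c * |x|)) := by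
    by_contra hni
    rw [integral_undef hni] at h
    exact (div_pos two_pos hc).ne h
  rw [← ofReal_integral_eq_lintegral_ofReal hi (ae_of_all _ fun x => (Real.exp_pos _).le), h]

theorem setLIntegral_exp_neg_mul_abs_sub_le {c : ℝ} (hc : 0 < c) (s : Set ℝ) (x : ℝ) :
    ∫⁻ y in s, ENNReal.ofReal (Real.exp (-(c * |x - y|))) ≤ ENNReal.ofReal (2 / c) := by
  rw [← lintegral_exp_neg_mul_abs hc,
    ← lintegral_sub_left_eq_self (fun y : ℝ => ENNReal.ofReal (Real.exp (-(c * |y|)))) x]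
  exact setLIntegral_le_lintegral _ _

theorem setLIntegral_inv_sqrt_sub {s A : ℝ} (h : s ≤ A) :
    ∫⁻ x in Set.Ioc s A, ENNReal.ofReal (Real.sqrt (x - s))⁻¹
      = ENNReal.ofReal (2 * Real.sqrt (A - s)) := by
  have hc : ContinuousOn (fun x => 2 * Real.sqrt (x - s)) (Set.Icc s A) := by fun_prop
  have hd : ∀ x ∈ Set.Ioo s A,
      HasDerivAt (fun x => 2 * Real.sqrt (x - s)) (Real.sqrt (x - s))⁻¹ x := by
    intro x hx
    have h1 := (((hasDerivAt_id x).sub_const s).sqrt (sub_pos.2 hx.1).ne').const_mul 2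
    convert! h1 using 1
    have : Real.sqrt (x - s) ≠ 0 := (Real.sqrt_pos.2 (sub_pos.2 hx.1)).ne'
    simp only [id]
    field_simp
  have hi : IntervalIntegrable (fun x => (Real.sqrt (x - s))⁻¹) volume s A := by
    refine intervalIntegral.intervalIntegrable_deriv_of_nonneg (by rwa [Set.uIcc_of_le h]) ?_ ?_
    · rwa [min_eq_left h, max_eq_right h]
    · exact fun x _ => by positivity
  have hv := intervalIntegral.integral_eq_sub_of_hasDerivAt_of_le h hc hd hi
  rw [intervalIntegral.integral_of_le h] at hv
  rw [← ofReal_integral_eq_lintegral_ofReal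
    ((intervalIntegrable_iff_integrableOn_Ioc_of_le h).1 hi)
    (ae_of_all _ fun x => by positivity), hv]
  simp

/-- Integrating x' and then y over the whole line gives the factors 2/(a y') and 2/(a x). There
remains (4/a²) (x y')^(-1/2), an integrable product singularity whose integral contributes 4 √(AB).
-/
theorem lintegral_cross_kernel_le {a A B : ℝ} (ha : 0 < a) (hA : 0 ≤ A) (hB : 0 ≤ B) :
    ∫⁻ z in Set.Ioc 0 B ×ˢ Set.Ioc 0 A, ∫⁻ z' in Set.Ioc 0 B ×ˢ Set.Ioc 0 A,
      ENNReal.ofReal (Real.sqrt (z.2 * z'.1) *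
        (Real.exp (-(a * z.2 * |z.1 - z'.1|)) * Real.exp (-(a * z'.1 * |z.2 - z'.2|))))
      ≤ ENNReal.ofReal (16 / a ^ 2 * Real.sqrt (A * B)) := by
  set νA : Measure ℝ := volume.restrict (Set.Ioc 0 A) with hνA
  set νB : Measure ℝ := volume.restrict (Set.Ioc 0 B) with hνB
  have hν : (volume : Measure (ℝ × ℝ)).restrict (Set.Ioc 0 B ×ˢ Set.Ioc 0 A) = νB.prod νA := by
    rw [hνA, hνB, Measure.prod_restrict, Measure.volume_eq_prod]
  rw [hν]
  set F : ℝ → ℝ → ℝ → ENNReal := fun y x y' =>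
    ENNReal.ofReal (2 / (a * y') * Real.sqrt (x * y')) *
      ENNReal.ofReal (Real.exp (-(a * x * |y - y'|))) with hF
  have hFm : Measurable fun p : ℝ × ℝ × ℝ => F p.1 p.2.1 p.2.2 := by
    simp only [hF]
    fun_prop
  have step : ∀ y x, ∫⁻ z', ENNReal.ofReal (Real.sqrt (x * z'.1) *
        (Real.exp (-(a * x * |y - z'.1|)) * Real.exp (-(a * z'.1 * |x - z'.2|)))) ∂νB.prod νA
      ≤ ∫⁻ y', F y x y' ∂νB := by
    intro y x
    refine (lintegral_prod_le _).trans (lintegral_mono_ae ?_)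
    filter_upwards [ae_restrict_mem measurableSet_Ioc] with y' hy'
    have hay : 0 < a * y' := mul_pos ha hy'.1
    simp_rw [← mul_assoc]
    rw [lintegral_congr fun x' : ℝ => ENNReal.ofReal_mul (by positivity),
      lintegral_const_mul' _ _ ENNReal.ofReal_ne_top]
    refine (mul_le_mul_right (setLIntegral_exp_neg_mul_abs_sub_le hay _ x) _).trans_eq ?_
    have hy0 := hy'.1
    simp only [hF]
    rw [← ENNReal.ofReal_mul (by positivity), ← ENNReal.ofReal_mul (by positivity)]
    congr 1
    ring
  calc _ ≤ ∫⁻ z, ∫⁻ y', F z.1 z.2 y' ∂νB ∂νB.prod νA := lintegral_mono fun z => step z.1 z.2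
    _ ≤ ∫⁻ y, ∫⁻ x, ∫⁻ y', F y x y' ∂νB ∂νA ∂νB := lintegral_prod_le _
    _ = ∫⁻ x, ∫⁻ y, ∫⁻ y', F y x y' ∂νB ∂νB ∂νA := by
        refine lintegral_lintegral_swap (Measurable.aemeasurable ?_)
        exact Measurable.lintegral_prod_right' (f := fun q : (ℝ × ℝ) × ℝ => F q.1.1 q.1.2 q.2)
          (hFm.comp (f := fun q : (ℝ × ℝ) × ℝ => (q.1.1, q.1.2, q.2)) (by fun_prop))
    _ = ∫⁻ x, ∫⁻ y', ∫⁻ y, F y x y' ∂νB ∂νB ∂νA := by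
        refine lintegral_congr fun x => lintegral_lintegral_swap (Measurable.aemeasurable ?_)
        exact hFm.comp (f := fun q : ℝ × ℝ => (q.1, x, q.2)) (by fun_prop)
    -- The subtracted zeros match `setLIntegral_inv_sqrt_sub` with left end point 0.
    _ ≤ ∫⁻ x, ∫⁻ y', ENNReal.ofReal (4 / a ^ 2 * (Real.sqrt (x - 0))⁻¹) *
          ENNReal.ofReal (Real.sqrt (y' - 0))⁻¹ ∂νB ∂νA := by
        refine lintegral_mono_ae ?_
        filter_upwards [ae_restrict_mem measurableSet_Ioc] with x hx
        refine lintegral_mono_ae ?_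
        filter_upwards [ae_restrict_mem measurableSet_Ioc] with y' hy'
        have hax : 0 < a * x := mul_pos ha hx.1
        have hx0 := hx.1
        have hy0 := hy'.1
        simp only [hF]
        rw [lintegral_const_mul' _ _ ENNReal.ofReal_ne_top]
        simp_rw [abs_sub_comm _ y']
        refine (mul_le_mul_right (setLIntegral_exp_neg_mul_abs_sub_le hax _ y') _).trans_eq ?_
        rw [← ENNReal.ofReal_mul (by positivity), ← ENNReal.ofReal_mul (by positivity)]
        congr 1
        rw [Real.sqrt_mul hx0.le, sub_zero, sub_zero]
        have h1 : Real.sqrt x ≠ 0 := (Real.sqrt_pos.2 hx0).ne'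
        have h2 : Real.sqrt y' ≠ 0 := (Real.sqrt_pos.2 hy0).ne'
        have h3 := Real.sq_sqrt hx0.le
        have h4 := Real.sq_sqrt hy0.le
        field_simp
        rw [h3, h4]
        ring
    _ = ENNReal.ofReal (16 / a ^ 2 * Real.sqrt (A * B)) := by
        simp_rw [lintegral_const_mul' _ _ ENNReal.ofReal_ne_top]
        rw [setLIntegral_inv_sqrt_sub hB, lintegral_mul_const' _ _ ENNReal.ofReal_ne_top,
          lintegral_congr fun x : ℝ => ENNReal.ofReal_mul (by positivity),
          lintegral_const_mul' _ _ ENNReal.ofReal_ne_top, setLIntegral_inv_sqrt_sub hA,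
          ← ENNReal.ofReal_mul (by positivity), ← ENNReal.ofReal_mul (by positivity),
          sub_zero, sub_zero, Real.sqrt_mul hA]
        congr 1
        ring

/-- The primed variables integrate to 4/(a² s t). For the rest, exp(-r) ≤ r^(-1/2) with r =
a(x-s)(y-t) yields the square root of the area of the box. Bounding the exponential by 1 would give
the area itself, which after rescaling leaves no decay in ε. -/
theorem lintegral_diagonal_kernel_le {a s t A B : ℝ} (ha : 0 < a) (hs : 0 < s) (ht : 0 < t)
    (hA : s ≤ A) (hB : t ≤ B) :
    ∫⁻ z in Set.Ioc t B ×ˢ Set.Ioc s A, ∫⁻ z' in Set.Ioc t B ×ˢ Set.Ioc s A,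
      ENNReal.ofReal (Real.exp (-(a * ((z.2 - s) * (z.1 - t)))) *
        (Real.exp (-(a * s * |z.1 - z'.1|)) * Real.exp (-(a * t * |z.2 - z'.2|))))
      ≤ ENNReal.ofReal (16 / (a ^ 2 * s * t * Real.sqrt a) * Real.sqrt ((A - s) * (B - t))) := by
  set νA : Measure ℝ := volume.restrict (Set.Ioc s A) with hνA
  set νB : Measure ℝ := volume.restrict (Set.Ioc t B) with hνB
  have hν : (volume : Measure (ℝ × ℝ)).restrict (Set.Ioc t B ×ˢ Set.Ioc s A) = νB.prod νA := by
    rw [hνA, hνB, Measure.prod_restrict, Measure.volume_eq_prod]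
  rw [hν]
  have inner : ∀ z : ℝ × ℝ, ∫⁻ z', ENNReal.ofReal (Real.exp (-(a * ((z.2 - s) * (z.1 - t)))) *
        (Real.exp (-(a * s * |z.1 - z'.1|)) * Real.exp (-(a * t * |z.2 - z'.2|)))) ∂νB.prod νA
      ≤ ENNReal.ofReal (Real.exp (-(a * ((z.2 - s) * (z.1 - t)))) * (4 / (a ^ 2 * s * t))) := by
    intro z
    refine (lintegral_prod_le _).trans ?_
    simp_rw [ENNReal.ofReal_mul (Real.exp_pos _).le,
      lintegral_const_mul' _ _ ENNReal.ofReal_ne_top]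
    refine mul_le_mul_right ?_ _
    refine (lintegral_mono fun y' => mul_le_mul_right
      (setLIntegral_exp_neg_mul_abs_sub_le (mul_pos ha ht) _ z.2) _).trans ?_
    rw [lintegral_mul_const' _ _ ENNReal.ofReal_ne_top]
    refine (mul_le_mul_left
      (setLIntegral_exp_neg_mul_abs_sub_le (mul_pos ha hs) _ z.1) _).trans_eq ?_
    rw [← ENNReal.ofReal_mul (by positivity)]
    congr 1
    field_simp
    ring
  calc _ ≤ ∫⁻ z, ENNReal.ofReal (Real.exp (-(a * ((z.2 - s) * (z.1 - t)))) *
            (4 / (a ^ 2 * s * t))) ∂νB.prod νA := lintegral_mono inner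
    _ ≤ ∫⁻ y, ∫⁻ x, ENNReal.ofReal (Real.exp (-(a * ((x - s) * (y - t)))) *
            (4 / (a ^ 2 * s * t))) ∂νA ∂νB := lintegral_prod_le _
    _ ≤ ∫⁻ y, ∫⁻ x, ENNReal.ofReal (4 / (a ^ 2 * s * t * Real.sqrt a)
          * (Real.sqrt (y - t))⁻¹) * ENNReal.ofReal (Real.sqrt (x - s))⁻¹ ∂νA ∂νB := by
        refine lintegral_mono_ae ?_
        filter_upwards [ae_restrict_mem measurableSet_Ioc] with y hy
        refine lintegral_mono_ae ?_
        filter_upwards [ae_restrict_mem measurableSet_Ioc] with x hx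
        have hp : 0 < x - s := sub_pos.2 hx.1
        have hq : 0 < y - t := sub_pos.2 hy.1
        rw [← ENNReal.ofReal_mul (by positivity)]
        refine ENNReal.ofReal_le_ofReal ?_
        have hr : 0 < a * ((x - s) * (y - t)) := by positivity
        -- With r = a(x-s)(y-t), this follows from √r ≤ 1 + r ≤ exp r.
        have hexp : Real.exp (-(a * ((x - s) * (y - t)))) ≤
            (Real.sqrt (a * ((x - s) * (y - t))))⁻¹ := by
          rw [Real.exp_neg]
          refine inv_anti₀ (Real.sqrt_pos.2 hr) ?_
          have h1 := Real.add_one_le_exp (a * ((x - s) * (y - t)))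
          have h2 := Real.sq_sqrt hr.le
          nlinarith [sq_nonneg (Real.sqrt (a * ((x - s) * (y - t))) - 1)]
        refine (mul_le_mul_of_nonneg_right hexp (by positivity)).trans_eq ?_
        rw [Real.sqrt_mul ha.le, Real.sqrt_mul hp.le]
        have h1 : Real.sqrt a ≠ 0 := (Real.sqrt_pos.2 ha).ne'
        have h2 : Real.sqrt (x - s) ≠ 0 := (Real.sqrt_pos.2 hp).ne'
        have h3 : Real.sqrt (y - t) ≠ 0 := (Real.sqrt_pos.2 hq).ne'
        field_simp
    _ = _ := by
        simp_rw [lintegral_const_mul' _ _ ENNReal.ofReal_ne_top]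
        rw [setLIntegral_inv_sqrt_sub hA, lintegral_mul_const' _ _ ENNReal.ofReal_ne_top,
          lintegral_congr fun x : ℝ => ENNReal.ofReal_mul (by positivity),
          lintegral_const_mul' _ _ ENNReal.ofReal_ne_top, setLIntegral_inv_sqrt_sub hB,
          ← ENNReal.ofReal_mul (by positivity), ← ENNReal.ofReal_mul (by positivity),
          Real.sqrt_mul (sub_nonneg.2 hA)]
        congr 1
        ring

end Kernels

/-! ### Second moments of the original and of the conditioned integrand -/

section SecondMoments

variable {Ω : Type*} [MeasurableSpace Ω] {L : ℝ≥0 → ℝ≥0 → Ω → ℝ} {Ψ : ℝ → ℂ} {μ : Measure Ω}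

theorem levyIntegrand_eq {Ω : Type*} (L : ℝ≥0 → ℝ≥0 → Ω → ℝ) (θ : ℝ) (ω : Ω) (x y : ℝ) :
    levyIntegrand L θ ω x y = (Real.sqrt (x * y) : ℂ) *
      Complex.exp (Complex.I * ((θ * L x.toNNReal y.toNNReal ω : ℝ) : ℂ)) := by
  rw [levyIntegrand, mul_comm Complex.I ((θ * L x.toNNReal y.toNNReal ω : ℝ) : ℂ),
    Complex.exp_mul_I, Complex.ofReal_cos, Complex.ofReal_sin, mul_comm Complex.I]

theorem exp_I_mul_conj (u v : ℝ) :
    Complex.exp (Complex.I * (u : ℂ)) * (starRingEnd ℂ) (Complex.exp (Complex.I * (v : ℂ))) =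
      Complex.exp (Complex.I * ((u - v : ℝ) : ℂ)) := by
  rw [← Complex.exp_conj, ← Complex.exp_add]
  simp
  ring_nf

theorem norm_exp_I_mul (u : ℝ) : ‖Complex.exp (Complex.I * (u : ℂ))‖ = 1 := by
  rw [mul_comm, Complex.norm_exp_ofReal_mul_I]

/-- Passing through the corner (x,y') splits L(x,y) - L(x',y') into increments over two strips,
disjoint because x ≤ x'. Of the weights, √(x'y) is absorbed into √(AB), while √(xy') is kept to tame
the factors 1/x and 1/y' produced by integrating the kernel. -/
theorem norm_correlation_levyIntegrand_le [IsProbabilityMeasure μ] (hL : IsLevySheet L Ψ μ)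
    (hm : ∀ x y, Measurable (L x y)) (θ : ℝ) {A B x y x' y' : ℝ}
    (hx : x ∈ Set.Ioc 0 A) (hy : y ∈ Set.Ioc 0 B) (hx' : x' ∈ Set.Ioc 0 A)
    (hy' : y' ∈ Set.Ioc 0 B) (hxx : x ≤ x') :
    ‖∫ ω, levyIntegrand L θ ω x y * (starRingEnd ℂ) (levyIntegrand L θ ω x' y') ∂μ‖ ≤
      Real.sqrt (A * B) * (Real.sqrt (x * y') * (Real.exp (-((Ψ θ).re * x * |y - y'|)) *
        Real.exp (-((Ψ θ).re * y' * |x - x'|)))) := by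
  have h1 : ∀ ω, levyIntegrand L θ ω x y * (starRingEnd ℂ) (levyIntegrand L θ ω x' y') =
      ((Real.sqrt (x * y) * Real.sqrt (x' * y') : ℝ) : ℂ) * Complex.exp (Complex.I *
        ((θ * ((L x.toNNReal y.toNNReal ω - L x.toNNReal y'.toNNReal ω) +
          (L x.toNNReal y'.toNNReal ω - L x'.toNNReal y'.toNNReal ω)) : ℝ) : ℂ)) := fun ω => by
    rw [levyIntegrand_eq, levyIntegrand_eq, map_mul, Complex.conj_ofReal, mul_mul_mul_comm,
      exp_I_mul_conj, Complex.ofReal_mul (Real.sqrt _)]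
    congr 4
    ring
  simp_rw [h1]
  rw [integral_const_mul, norm_mul, hL.norm_char_cross hm θ _ _ _ le_rfl
    (Real.toNNReal_le_toNNReal hxx), Complex.norm_real, Real.norm_of_nonneg (by positivity),
    Real.coe_toNNReal _ hx.1.le, Real.coe_toNNReal _ hx'.1.le, Real.coe_toNNReal _ hy.1.le,
    Real.coe_toNNReal _ hy'.1.le, ← Real.exp_add]
  have h2 : Real.sqrt (x * y) * Real.sqrt (x' * y') ≤ Real.sqrt (A * B) * Real.sqrt (x * y') := by
    rw [← Real.sqrt_mul (mul_nonneg hx.1.le hy.1.le),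
      ← Real.sqrt_mul (mul_nonneg (hx.1.le.trans hx.2) (hy.1.le.trans hy.2))]
    refine Real.sqrt_le_sqrt ?_
    have h3 : x' * y ≤ A * B := mul_le_mul hx'.2 hy.2 hy.1.le (hx.1.le.trans hx.2)
    have h4 : 0 ≤ x * y' := mul_nonneg hx.1.le hy'.1.le
    nlinarith
  rw [← mul_assoc (Real.sqrt (A * B))]
  refine (mul_le_mul_of_nonneg_right h2 (Real.exp_pos _).le).trans_eq ?_
  congr 2
  ring

theorem measurable_sheet (hLm : Measurable fun p : (ℝ≥0 × ℝ≥0) × Ω => L p.1.1 p.1.2 p.2)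
    (x y : ℝ≥0) : Measurable (L x y) :=
  hLm.comp (f := fun ω => ((x, y), ω)) (by fun_prop)

/-- The second moment of the integral of `√(xy) exp(iθL(x,y))` over a box. -/
theorem lintegral_enorm_box_sq_le [IsProbabilityMeasure μ] (hL : IsLevySheet L Ψ μ)
    (hLm : Measurable fun p : (ℝ≥0 × ℝ≥0) × Ω => L p.1.1 p.1.2 p.2) {θ : ℝ}
    (ha : 0 < (Ψ θ).re) {A B : ℝ} (hA : 0 ≤ A) (hB : 0 ≤ B) :
    ∫⁻ ω, ‖∫ p in Set.Ioc 0 B ×ˢ Set.Ioc 0 A, levyIntegrand L θ ω p.2 p.1‖ₑ ^ 2 ∂μ ≤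
      ENNReal.ofReal (32 / (Ψ θ).re ^ 2 * (A * B)) := by
  set a := (Ψ θ).re with hadef
  have hm := measurable_sheet hLm
  set ν : Measure (ℝ × ℝ) := volume.restrict (Set.Ioc 0 B ×ˢ Set.Ioc 0 A) with hν
  have hfin : IsFiniteMeasure ν := ⟨by
    rw [hν, Measure.restrict_apply_univ, Measure.volume_eq_prod, Measure.prod_prod]
    exact ENNReal.mul_lt_top measure_Ioc_lt_top measure_Ioc_lt_top⟩
  have hmem : ∀ᵐ p ∂ν, p ∈ Set.Ioc 0 B ×ˢ Set.Ioc 0 A :=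
    ae_restrict_mem (measurableSet_Ioc.prod measurableSet_Ioc)
  set k : ℝ × ℝ → ℝ × ℝ → ENNReal := fun z z' => ENNReal.ofReal (Real.sqrt (z.2 * z'.1) *
        (Real.exp (-(a * z.2 * |z.1 - z'.1|)) * Real.exp (-(a * z'.1 * |z.2 - z'.2|)))) with hk
  have hkm : Measurable (Function.uncurry k) := by
    simp only [hk, Function.uncurry_def]
    fun_prop
  have hf : Measurable (Function.uncurry fun (p : ℝ × ℝ) ω => levyIntegrand L θ ω p.2 p.1) :=
    (measurable_levyIntegrand hLm θ).comp
      (f := fun q : (ℝ × ℝ) × Ω => (q.2, (q.1.2, q.1.1))) (by fun_prop)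
  have hkint : ∫⁻ z, ∫⁻ z', k z z' ∂ν ∂ν ≤ ENNReal.ofReal (16 / a ^ 2 * Real.sqrt (A * B)) :=
    lintegral_cross_kernel_le ha hA hB
  -- The correlation bound needs the abscissae ordered. Adding the kernel with swapped arguments
  -- covers both orders and doubles the constant 16 to 32.
  refine (lintegral_enorm_integral_sq_le (ν := ν) (G := fun _ => Real.sqrt (A * B) * 2)
    (κ := fun z z' => ENNReal.ofReal (Real.sqrt (A * B)) * (k z z' + k z' z))
    hf (integrable_const _) ?_ ?_).trans ?_
  · filter_upwards [hmem] with p hp ω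
    exact norm_levyIntegrand_le_box L θ ω hp.2 hp.1
  · filter_upwards [hmem] with z hz
    filter_upwards [hmem] with z' hz'
    rw [← ofReal_norm, mul_add]
    rcases le_total z.2 z'.2 with h | h
    · refine le_trans (ENNReal.ofReal_le_ofReal
        (norm_correlation_levyIntegrand_le hL hm θ hz.2 hz.1 hz'.2 hz'.1 h)) ?_
      rw [ENNReal.ofReal_mul (Real.sqrt_nonneg _)]
      exact le_self_add
    · have hsymm : ‖∫ ω, levyIntegrand L θ ω z.2 z.1 *
          (starRingEnd ℂ) (levyIntegrand L θ ω z'.2 z'.1) ∂μ‖ = ‖∫ ω, levyIntegrand L θ ω z'.2 z'.1 *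
          (starRingEnd ℂ) (levyIntegrand L θ ω z.2 z.1) ∂μ‖ := by
        rw [← RCLike.norm_conj (∫ ω, _ ∂μ), ← integral_conj]
        simp_rw [map_mul, Complex.conj_conj, mul_comm]
      rw [hsymm]
      refine le_trans (ENNReal.ofReal_le_ofReal
        (norm_correlation_levyIntegrand_le hL hm θ hz'.2 hz'.1 hz.2 hz.1 h)) ?_
      rw [ENNReal.ofReal_mul (Real.sqrt_nonneg _)]
      exact le_add_self
  · simp_rw [lintegral_const_mul' _ _ ENNReal.ofReal_ne_top]
    have h1 : ∀ z, ∫⁻ z', (k z z' + k z' z) ∂ν = ∫⁻ z', k z z' ∂ν + ∫⁻ z', k z' z ∂ν := fun z =>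
      lintegral_add_left (hkm.comp (f := fun z' => (z, z')) (by fun_prop)) _
    simp_rw [h1]
    rw [lintegral_add_left (f := fun z => ∫⁻ z', k z z' ∂ν) hkm.lintegral_prod_right', lintegral_lintegral_swap
      (f := fun z z' => k z' z) (hkm.comp measurable_swap).aemeasurable]
    refine (mul_le_mul_right (add_le_add hkint hkint) _).trans_eq ?_
    rw [← ENNReal.ofReal_add (by positivity) (by positivity), ← ENNReal.ofReal_mul (by positivity)]
    congr 1
    have h2 := Real.mul_self_sqrt (mul_nonneg hA hB)
    linear_combination (32 / a ^ 2) * h2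

/-- The conditional expectation of `√(xy) exp(iθL(x,y))`, for `x ≥ s` and `y ≥ t`, given the values
of the sheet to the left of `s` and below `t`. -/
noncomputable def levyIntegrandPast (L : ℝ≥0 → ℝ≥0 → Ω → ℝ) (Ψ : ℝ → ℂ) (θ s t : ℝ) (ω : Ω) (x y : ℝ) : ℂ :=
  ((Real.sqrt (x * y) : ℂ) * Complex.exp (-(((x - s) * (y - t) : ℝ) : ℂ) * Ψ θ)) *
    Complex.exp (Complex.I * ((θ * (L s.toNNReal y.toNNReal ω + L x.toNNReal t.toNNReal ω
      - L s.toNNReal t.toNNReal ω) : ℝ) : ℂ))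

theorem norm_levyIntegrandPast {Ω : Type*} (L : ℝ≥0 → ℝ≥0 → Ω → ℝ) (Ψ : ℝ → ℂ) (θ s t : ℝ) (ω : Ω) (x y : ℝ) :
    ‖levyIntegrandPast L Ψ θ s t ω x y‖ =
      Real.sqrt (x * y) * Real.exp (-((Ψ θ).re * ((x - s) * (y - t)))) := by
  rw [levyIntegrandPast, norm_mul, norm_exp_I_mul, mul_one, norm_mul, Complex.norm_real,
    Real.norm_of_nonneg (Real.sqrt_nonneg _), Complex.norm_exp]
  congr 2
  rw [← Complex.ofReal_neg, Complex.re_ofReal_mul]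
  ring

theorem measurable_levyIntegrandPast
    (hLm : Measurable fun p : (ℝ≥0 × ℝ≥0) × Ω => L p.1.1 p.1.2 p.2) (Ψ : ℝ → ℂ) (θ s t : ℝ) :
    Measurable (Function.uncurry fun (p : ℝ × ℝ) ω => levyIntegrandPast L Ψ θ s t ω p.2 p.1) := by
  have h1 : Measurable fun q : (ℝ × ℝ) × Ω => L s.toNNReal q.1.1.toNNReal q.2 :=
    hLm.comp (f := fun q : (ℝ × ℝ) × Ω => ((s.toNNReal, q.1.1.toNNReal), q.2)) (by fun_prop)
  have h2 : Measurable fun q : (ℝ × ℝ) × Ω => L q.1.2.toNNReal t.toNNReal q.2 :=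
    hLm.comp (f := fun q : (ℝ × ℝ) × Ω => ((q.1.2.toNNReal, t.toNNReal), q.2)) (by fun_prop)
  have h3 : Measurable fun q : (ℝ × ℝ) × Ω => L s.toNNReal t.toNNReal q.2 :=
    (measurable_sheet hLm _ _).comp measurable_snd
  simp only [Function.uncurry_def, levyIntegrandPast]
  exact Measurable.mul (by fun_prop) (Complex.measurable_exp.comp
    (measurable_const.mul (Complex.measurable_ofReal.comp (((h1.add h2).sub h3).const_mul θ))))

/-- In the product with the conjugate the terms L(s,t) cancel, leaving a cross of strips of fixed
widths s and t. Only one of the two damping factors is retained; the other is at most 1. -/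
theorem norm_correlation_levyIntegrandPast_le [IsProbabilityMeasure μ] (hL : IsLevySheet L Ψ μ)
    (hm : ∀ x y, Measurable (L x y)) {θ : ℝ} (ha : 0 < (Ψ θ).re) {s t A B x y x' y' : ℝ}
    (hs : 0 < s) (ht : 0 < t)
    (hx : x ∈ Set.Ioc s A) (hy : y ∈ Set.Ioc t B) (hx' : x' ∈ Set.Ioc s A)
    (hy' : y' ∈ Set.Ioc t B) :
    ‖∫ ω, levyIntegrandPast L Ψ θ s t ω x y *
        (starRingEnd ℂ) (levyIntegrandPast L Ψ θ s t ω x' y') ∂μ‖ ≤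
      (A * B) * (Real.exp (-((Ψ θ).re * ((x - s) * (y - t)))) *
        (Real.exp (-((Ψ θ).re * s * |y - y'|)) * Real.exp (-((Ψ θ).re * t * |x - x'|)))) := by
  set c : ℝ → ℝ → ℂ := fun x y =>
    (Real.sqrt (x * y) : ℂ) * Complex.exp (-(((x - s) * (y - t) : ℝ) : ℂ) * Ψ θ) with hc
  have hcn : ∀ x y, ‖c x y‖ = Real.sqrt (x * y) * Real.exp (-((Ψ θ).re * ((x - s) * (y - t)))) := by
    intro x y
    rw [hc, norm_mul, Complex.norm_real, Real.norm_of_nonneg (Real.sqrt_nonneg _), Complex.norm_exp]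
    congr 2
    rw [← Complex.ofReal_neg, Complex.re_ofReal_mul]
    ring
  have h1 : ∀ ω, levyIntegrandPast L Ψ θ s t ω x y *
      (starRingEnd ℂ) (levyIntegrandPast L Ψ θ s t ω x' y') =
      (c x y * (starRingEnd ℂ) (c x' y')) * Complex.exp (Complex.I *
        ((θ * ((L s.toNNReal y.toNNReal ω - L s.toNNReal y'.toNNReal ω) +
          (L x.toNNReal t.toNNReal ω - L x'.toNNReal t.toNNReal ω)) : ℝ) : ℂ)) := fun ω => by
    rw [levyIntegrandPast, levyIntegrandPast, map_mul, mul_mul_mul_comm, exp_I_mul_conj]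
    congr 4
    ring
  simp_rw [h1]
  rw [integral_const_mul, norm_mul, hL.norm_char_cross hm θ _ _ _
    (Real.toNNReal_le_toNNReal hx.1.le) (Real.toNNReal_le_toNNReal hx'.1.le), norm_mul,
    RCLike.norm_conj, hcn, hcn,
    Real.coe_toNNReal _ (hs.trans hx.1).le, Real.coe_toNNReal _ (hs.trans hx'.1).le,
    Real.coe_toNNReal _ (ht.trans hy.1).le, Real.coe_toNNReal _ (ht.trans hy'.1).le,
    Real.coe_toNNReal _ hs.le, Real.coe_toNNReal _ ht.le, ← Real.exp_add (-(_ * s * _))]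
  have hAB : 0 ≤ A * B := mul_nonneg (hs.le.trans (hx.1.le.trans hx.2))
    (ht.le.trans (hy.1.le.trans hy.2))
  have h2 : Real.sqrt (x * y) ≤ Real.sqrt (A * B) := Real.sqrt_le_sqrt
    (mul_le_mul hx.2 hy.2 (ht.trans hy.1).le (hs.le.trans (hx.1.le.trans hx.2)))
  have h3 : Real.sqrt (x' * y') ≤ Real.sqrt (A * B) := Real.sqrt_le_sqrt
    (mul_le_mul hx'.2 hy'.2 (ht.trans hy'.1).le (hs.le.trans (hx.1.le.trans hx.2)))
  have h4 : Real.exp (-((Ψ θ).re * ((x' - s) * (y' - t)))) ≤ 1 := by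
    rw [Real.exp_le_one_iff]
    have := mul_pos (sub_pos.2 hx'.1) (sub_pos.2 hy'.1)
    nlinarith [mul_pos ha this]
  rw [← mul_assoc (A * B)]
  refine mul_le_mul ?_ (Real.exp_le_exp.2 (le_of_eq (by ring))) (Real.exp_pos _).le (by positivity)
  calc _ ≤ (Real.sqrt (A * B) * Real.exp (-((Ψ θ).re * ((x - s) * (y - t))))) *
        (Real.sqrt (A * B) * 1) := by gcongr
    _ = _ := by
        have := Real.mul_self_sqrt hAB
        linear_combination Real.exp (-((Ψ θ).re * ((x - s) * (y - t)))) * this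

theorem lintegral_enorm_past_sq_le [IsProbabilityMeasure μ] (hL : IsLevySheet L Ψ μ)
    (hLm : Measurable fun p : (ℝ≥0 × ℝ≥0) × Ω => L p.1.1 p.1.2 p.2) {θ : ℝ}
    (ha : 0 < (Ψ θ).re) {s t A B : ℝ} (hs : 0 < s) (ht : 0 < t) (hA : s ≤ A) (hB : t ≤ B) :
    ∫⁻ ω, ‖∫ p in Set.Ioc t B ×ˢ Set.Ioc s A, levyIntegrandPast L Ψ θ s t ω p.2 p.1‖ₑ ^ 2 ∂μ ≤
      ENNReal.ofReal ((A * B) * (16 / ((Ψ θ).re ^ 2 * s * t * Real.sqrt (Ψ θ).re) *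
        Real.sqrt ((A - s) * (B - t)))) := by
  set a := (Ψ θ).re with hadef
  have hm := measurable_sheet hLm
  set ν : Measure (ℝ × ℝ) := volume.restrict (Set.Ioc t B ×ˢ Set.Ioc s A) with hν
  have hfin : IsFiniteMeasure ν := ⟨by
    rw [hν, Measure.restrict_apply_univ, Measure.volume_eq_prod, Measure.prod_prod]
    exact ENNReal.mul_lt_top measure_Ioc_lt_top measure_Ioc_lt_top⟩
  have hmem : ∀ᵐ p ∂ν, p ∈ Set.Ioc t B ×ˢ Set.Ioc s A :=
    ae_restrict_mem (measurableSet_Ioc.prod measurableSet_Ioc)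
  have hAB : 0 ≤ A * B := mul_nonneg (hs.le.trans hA) (ht.le.trans hB)
  refine (lintegral_enorm_integral_sq_le (ν := ν) (G := fun _ => Real.sqrt (A * B) * 1)
    (κ := fun z z' => ENNReal.ofReal (A * B) * ENNReal.ofReal
      (Real.exp (-(a * ((z.2 - s) * (z.1 - t)))) *
        (Real.exp (-(a * s * |z.1 - z'.1|)) * Real.exp (-(a * t * |z.2 - z'.2|)))))
    (measurable_levyIntegrandPast hLm Ψ θ s t) (integrable_const _) ?_ ?_).trans ?_
  · filter_upwards [hmem] with p hp ω
    rw [norm_levyIntegrandPast]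
    have h4 : Real.exp (-((Ψ θ).re * ((p.2 - s) * (p.1 - t)))) ≤ 1 := by
      rw [Real.exp_le_one_iff]
      have := mul_pos (sub_pos.2 hp.2.1) (sub_pos.2 hp.1.1)
      nlinarith [mul_pos ha this]
    exact mul_le_mul (Real.sqrt_le_sqrt
      (mul_le_mul hp.2.2 hp.1.2 (ht.trans hp.1.1).le (hs.le.trans hA))) h4
      (Real.exp_pos _).le (Real.sqrt_nonneg _)
  · filter_upwards [hmem] with z hz
    filter_upwards [hmem] with z' hz'
    rw [← ofReal_norm, ← ENNReal.ofReal_mul hAB]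
    exact ENNReal.ofReal_le_ofReal
      (norm_correlation_levyIntegrandPast_le hL hm ha hs ht hz.2 hz.1 hz'.2 hz'.1)
  · simp_rw [lintegral_const_mul' _ _ ENNReal.ofReal_ne_top]
    refine (mul_le_mul_right (lintegral_diagonal_kernel_le ha hs ht hA hB) _).trans_eq ?_
    rw [← ENNReal.ofReal_mul hAB]

end SecondMoments

/-! ### Conditioning on the past of the sheet -/

/-- The σ-algebra generated by the values `L(x,y)` with `x ≤ s` or `y ≤ t`. -/
abbrev sheetPast {Ω : Type*} (L : ℝ≥0 → ℝ≥0 → Ω → ℝ) (s t : ℝ≥0) : MeasurableSpace Ω :=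
  MeasurableSpace.comap
    (fun ω (z : {z : ℝ≥0 × ℝ≥0 // z.1 ≤ s ∨ z.2 ≤ t}) => L z.1.1 z.1.2 ω) MeasurableSpace.pi

theorem measurable_sheetPast {Ω : Type*} (L : ℝ≥0 → ℝ≥0 → Ω → ℝ) {s t x y : ℝ≥0}
    (h : x ≤ s ∨ y ≤ t) : Measurable[sheetPast L s t] (L x y) :=
  (measurable_pi_apply (⟨(x, y), h⟩ : {z : ℝ≥0 × ℝ≥0 // z.1 ≤ s ∨ z.2 ≤ t})).comp
    (comap_measurable
      (fun ω (z : {z : ℝ≥0 × ℝ≥0 // z.1 ≤ s ∨ z.2 ≤ t}) => L z.1.1 z.1.2 ω))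

section Past

variable {Ω : Type*} [m0 : MeasurableSpace Ω] {L : ℝ≥0 → ℝ≥0 → Ω → ℝ} {Ψ : ℝ → ℂ} {μ : Measure Ω}

theorem sheetPast_le (hm : ∀ x y, Measurable (L x y)) (s t : ℝ≥0) : sheetPast L s t ≤ m0 :=
  (measurable_pi_lambda _ fun _ => hm _ _).comap_le

theorem measurable_levyIntegrand_sheetPast {Ω : Type*} {L : ℝ≥0 → ℝ≥0 → Ω → ℝ} (θ : ℝ) {s t : ℝ≥0} {x y : ℝ}
    (h : x.toNNReal ≤ s ∨ y.toNNReal ≤ t) :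
    Measurable[sheetPast L s t] fun ω => levyIntegrand L θ ω x y := by
  simp_rw [levyIntegrand_eq]
  exact (Complex.measurable_exp.comp (measurable_const.mul (Complex.measurable_ofReal.comp
    ((measurable_sheetPast L h).const_mul θ)))).const_mul _

theorem aestronglyMeasurable_box_sheetPast [IsProbabilityMeasure μ]
    (hLm : Measurable fun p : (ℝ≥0 × ℝ≥0) × Ω => L p.1.1 p.1.2 p.2) (θ : ℝ) {s t : ℝ≥0} {A B : ℝ}
    (h : A ≤ s ∨ B ≤ t) :
    AEStronglyMeasurable[sheetPast L s t]
      (fun ω => ∫ p in Set.Ioc 0 B ×ˢ Set.Ioc 0 A, levyIntegrand L θ ω p.2 p.1) μ := by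
  have hm := measurable_sheet hLm
  set ν : Measure (ℝ × ℝ) := volume.restrict (Set.Ioc 0 B ×ˢ Set.Ioc 0 A) with hν
  have hfin : IsFiniteMeasure ν := ⟨by
    rw [hν, Measure.restrict_apply_univ, Measure.volume_eq_prod, Measure.prod_prod]
    exact ENNReal.mul_lt_top measure_Ioc_lt_top measure_Ioc_lt_top⟩
  have hmem : ∀ᵐ p ∂ν, p ∈ Set.Ioc 0 B ×ˢ Set.Ioc 0 A :=
    ae_restrict_mem (measurableSet_Ioc.prod measurableSet_Ioc)
  have hf : Measurable (Function.uncurry fun (p : ℝ × ℝ) ω => levyIntegrand L θ ω p.2 p.1) :=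
    (measurable_levyIntegrand hLm θ).comp
      (f := fun q : (ℝ × ℝ) × Ω => (q.2, (q.1.2, q.1.1))) (by fun_prop)
  have hpast : ∀ᵐ p ∂ν, Measurable[sheetPast L s t] fun ω => levyIntegrand L θ ω p.2 p.1 := by
    filter_upwards [hmem] with p hp
    refine measurable_levyIntegrand_sheetPast θ ?_
    rcases h with h | h
    · exact Or.inl (Real.toNNReal_le_iff_le_coe.2 (hp.2.2.trans h))
    · exact Or.inr (Real.toNNReal_le_iff_le_coe.2 (hp.1.2.trans h))
  have hre : AEStronglyMeasurable[sheetPast L s t]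
      (fun ω => ∫ p, (levyIntegrand L θ ω p.2 p.1).re ∂ν) μ := by
    refine aestronglyMeasurable_integral_of_forall (sheetPast_le hm s t)
      (Complex.measurable_re.comp hf) (integrable_const (Real.sqrt (A * B) * 2)) ?_ ?_
    · filter_upwards [hmem] with p hp ω
      exact (Complex.abs_re_le_norm _).trans (norm_levyIntegrand_le_box L θ ω hp.2 hp.1)
    · filter_upwards [hpast] with p hp
      exact (Complex.measurable_re.comp hp).stronglyMeasurable
  have him : AEStronglyMeasurable[sheetPast L s t]
      (fun ω => ∫ p, (levyIntegrand L θ ω p.2 p.1).im ∂ν) μ := by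
    refine aestronglyMeasurable_integral_of_forall (sheetPast_le hm s t)
      (Complex.measurable_im.comp hf) (integrable_const (Real.sqrt (A * B) * 2)) ?_ ?_
    · filter_upwards [hmem] with p hp ω
      exact (Complex.abs_im_le_norm _).trans (norm_levyIntegrand_le_box L θ ω hp.2 hp.1)
    · filter_upwards [hpast] with p hp
      exact (Complex.measurable_im.comp hp).stronglyMeasurable
  have heq : ∀ ω, ∫ p, levyIntegrand L θ ω p.2 p.1 ∂ν =
      ((∫ p, (levyIntegrand L θ ω p.2 p.1).re ∂ν : ℝ) : ℂ) +
        ((∫ p, (levyIntegrand L θ ω p.2 p.1).im ∂ν : ℝ) : ℂ) * Complex.I := fun ω =>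
    (integral_re_add_im (𝕜 := ℂ) (integrableOn_levyIntegrand hLm θ ω A B)).symm
  simp_rw [heq]
  exact (Complex.continuous_ofReal.comp_aestronglyMeasurable hre).add
    ((Complex.continuous_ofReal.comp_aestronglyMeasurable him).mul aestronglyMeasurable_const)

/-- Conditioning `√(xy) exp(iθL(x,y))` on the past. -/
theorem integral_past_mul_levyIntegrand [IsProbabilityMeasure μ] (hL : IsLevySheet L Ψ μ)
    (hm : ∀ x y, Measurable (L x y)) (θ : ℝ) {s t x y : ℝ} (hs : 0 < s) (ht : 0 < t)
    (hx : s < x) (hy : t < y) {φ : Ω → ℂ}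
    (hφ : AEStronglyMeasurable[sheetPast L s.toNNReal t.toNNReal] φ μ) :
    ∫ ω, φ ω * levyIntegrand L θ ω x y ∂μ = ∫ ω, φ ω * levyIntegrandPast L Ψ θ s t ω x y ∂μ := by
  obtain ⟨φ', hφ', hφφ'⟩ := hφ
  have hx0 := hs.trans hx
  have hy0 := ht.trans hy
  set Q : QuadrantRect := ⟨s.toNNReal, x.toNNReal, t.toNNReal, y.toNNReal,
    (Real.toNNReal_lt_toNNReal_iff hx0).2 hx, (Real.toNNReal_lt_toNNReal_iff hy0).2 hy⟩ with hQ
  have harea : Q.area = (x - s) * (y - t) := by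
    simp only [hQ, QuadrantRect.area, Real.coe_toNNReal _ hs.le, Real.coe_toNNReal _ ht.le,
      Real.coe_toNNReal _ hx0.le, Real.coe_toNNReal _ hy0.le]
  -- `V` collects all past factors of the integrand. What remains is a function of the increment
  -- over `Q`, independent of `V`, whose mean is given by the exponent.
  set V : Ω → ℂ := fun ω => φ' ω * Complex.exp (Complex.I *
    ((θ * (L s.toNNReal y.toNNReal ω + L x.toNNReal t.toNNReal ω
      - L s.toNNReal t.toNNReal ω) : ℝ) : ℂ)) with hV
  have hVm : Measurable[sheetPast L s.toNNReal t.toNNReal] V :=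
    hφ'.measurable.mul (Complex.measurable_exp.comp (measurable_const.mul
      (Complex.measurable_ofReal.comp ((((measurable_sheetPast L (Or.inl le_rfl)).add
        (measurable_sheetPast L (Or.inr le_rfl))).sub
          (measurable_sheetPast L (Or.inl le_rfl))).const_mul θ))))
  have hQm : Measurable (Q.increment L) := (((hm _ _).sub (hm _ _)).sub (hm _ _)).add (hm _ _)
  have hind : IndepFun (Q.increment L) V μ := by
    rw [IndepFun_iff_Indep]
    exact indep_of_indep_of_le_right (hL.indepFun_increment_past hm Q) hVm.comap_le
  have hmul := (hind.comp (φ := fun r : ℝ => Complex.exp (Complex.I * ((θ * r : ℝ) : ℂ)))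
    (ψ := id) (by fun_prop) measurable_id).integral_mul_eq_mul_integral
    (Measurable.aestronglyMeasurable (by fun_prop))
    (hVm.mono (sheetPast_le hm _ _) le_rfl).aestronglyMeasurable
  simp only [Function.comp_def, id, Pi.mul_apply] at hmul
  rw [hL.char_increment, harea] at hmul
  calc ∫ ω, φ ω * levyIntegrand L θ ω x y ∂μ
      = ∫ ω, (Real.sqrt (x * y) : ℂ) *
          (Complex.exp (Complex.I * ((θ * Q.increment L ω : ℝ) : ℂ)) * V ω) ∂μ := by
        refine integral_congr_ae ?_
        filter_upwards [hφφ'] with ω hω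
        rw [hω, levyIntegrand_eq, hV]
        have h1 : (θ * L x.toNNReal y.toNNReal ω : ℝ) = θ * Q.increment L ω +
            θ * (L s.toNNReal y.toNNReal ω + L x.toNNReal t.toNNReal ω
              - L s.toNNReal t.toNNReal ω) := by
          simp only [hQ, QuadrantRect.increment]
          ring
        rw [h1, Complex.ofReal_add, mul_add, Complex.exp_add]
        ring
    _ = (Real.sqrt (x * y) : ℂ) * (Complex.exp (-(((x - s) * (y - t) : ℝ) : ℂ) * Ψ θ) *
          ∫ ω, V ω ∂μ) := by rw [integral_const_mul, hmul]
    _ = ∫ ω, φ ω * levyIntegrandPast L Ψ θ s t ω x y ∂μ := by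
        rw [← mul_assoc, ← integral_const_mul]
        refine integral_congr_ae ?_
        filter_upwards [hφφ'] with ω hω
        rw [hω, levyIntegrandPast, hV]
        ring

theorem sq_lintegral_le [IsProbabilityMeasure μ] {f : Ω → ENNReal} (hf : AEMeasurable f μ) :
    (∫⁻ ω, f ω ∂μ) ^ 2 ≤ ∫⁻ ω, f ω ^ 2 ∂μ := by
  have h := ENNReal.lintegral_mul_le_Lp_mul_Lq μ Real.HolderConjugate.two_two hf
    (aemeasurable_const (b := (1 : ENNReal)))
  simp only [Pi.mul_apply, mul_one, ENNReal.one_rpow, lintegral_const, measure_univ,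
    ENNReal.rpow_two, one_pow] at h
  calc (∫⁻ ω, f ω ∂μ) ^ 2 ≤ ((∫⁻ ω, f ω ^ 2 ∂μ) ^ (1 / 2 : ℝ)) ^ 2 := by gcongr
    _ = ∫⁻ ω, f ω ^ 2 ∂μ := by
        rw [← ENNReal.rpow_two, ← ENNReal.rpow_mul]
        norm_num

/-- The integral of `√(xy) exp(iθL(x,y))` over a box is almost orthogonal to the past. -/
theorem enorm_integral_past_mul_sq_le [IsProbabilityMeasure μ] (hL : IsLevySheet L Ψ μ)
    (hLm : Measurable fun p : (ℝ≥0 × ℝ≥0) × Ω => L p.1.1 p.1.2 p.2) {θ : ℝ}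
    (ha : 0 < (Ψ θ).re) {s t A B : ℝ} (hs : 0 < s) (ht : 0 < t) (hA : s ≤ A) (hB : t ≤ B)
    {φ : Ω → ℂ} (hφ : AEStronglyMeasurable[sheetPast L s.toNNReal t.toNNReal] φ μ)
    (hφ1 : ∀ ω, ‖φ ω‖ ≤ 1) :
    ‖∫ ω, φ ω * (∫ p in Set.Ioc t B ×ˢ Set.Ioc s A, levyIntegrand L θ ω p.2 p.1) ∂μ‖ₑ ^ 2 ≤
      ENNReal.ofReal ((A * B) * (16 / ((Ψ θ).re ^ 2 * s * t * Real.sqrt (Ψ θ).re) *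
        Real.sqrt ((A - s) * (B - t)))) := by
  have hm := measurable_sheet hLm
  have hφ0 : AEStronglyMeasurable φ μ := hφ.mono (sheetPast_le hm _ _)
  set ν : Measure (ℝ × ℝ) := volume.restrict (Set.Ioc t B ×ˢ Set.Ioc s A) with hν
  have hfin : IsFiniteMeasure ν := ⟨by
    rw [hν, Measure.restrict_apply_univ, Measure.volume_eq_prod, Measure.prod_prod]
    exact ENNReal.mul_lt_top measure_Ioc_lt_top measure_Ioc_lt_top⟩
  have hmem : ∀ᵐ p ∂ν, p ∈ Set.Ioc t B ×ˢ Set.Ioc s A :=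
    ae_restrict_mem (measurableSet_Ioc.prod measurableSet_Ioc)
  have hf : Measurable fun q : Ω × (ℝ × ℝ) => levyIntegrand L θ q.1 q.2.2 q.2.1 :=
    (measurable_levyIntegrand hLm θ).comp
      (f := fun q : Ω × (ℝ × ℝ) => (q.1, (q.2.2, q.2.1))) (by fun_prop)
  have hg : Measurable fun q : Ω × (ℝ × ℝ) => levyIntegrandPast L Ψ θ s t q.1 q.2.2 q.2.1 :=
    (measurable_levyIntegrandPast hLm Ψ θ s t).comp measurable_swap
  have hbox : ∀ {p : ℝ × ℝ}, p ∈ Set.Ioc t B ×ˢ Set.Ioc s A →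
      p.2 ∈ Set.Ioc 0 A ∧ p.1 ∈ Set.Ioc 0 B := fun hp =>
    ⟨⟨hs.trans hp.2.1, hp.2.2⟩, ⟨ht.trans hp.1.1, hp.1.2⟩⟩
  have hfi : Integrable (fun q : Ω × (ℝ × ℝ) => φ q.1 * levyIntegrand L θ q.1 q.2.2 q.2.1)
      (μ.prod ν) := by
    refine Integrable.of_bound (hφ0.comp_fst.mul hf.aestronglyMeasurable)
      (1 * (Real.sqrt (A * B) * 2)) ?_
    filter_upwards [Measure.quasiMeasurePreserving_snd.ae hmem] with q hq
    rw [norm_mul]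
    exact mul_le_mul (hφ1 _) (norm_levyIntegrand_le_box L θ q.1 (hbox hq).1 (hbox hq).2)
      (norm_nonneg _) zero_le_one
  have hgi : Integrable (fun q : Ω × (ℝ × ℝ) => φ q.1 * levyIntegrandPast L Ψ θ s t q.1 q.2.2 q.2.1)
      (μ.prod ν) := by
    refine Integrable.of_bound (hφ0.comp_fst.mul hg.aestronglyMeasurable)
      (1 * (Real.sqrt (A * B) * 1)) ?_
    filter_upwards [Measure.quasiMeasurePreserving_snd.ae hmem] with q hq
    rw [norm_mul, norm_levyIntegrandPast]
    have h4 : Real.exp (-((Ψ θ).re * ((q.2.2 - s) * (q.2.1 - t)))) ≤ 1 := by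
      rw [Real.exp_le_one_iff]
      have := mul_pos (sub_pos.2 hq.2.1) (sub_pos.2 hq.1.1)
      nlinarith [mul_pos ha this]
    exact mul_le_mul (hφ1 _) (mul_le_mul (Real.sqrt_le_sqrt
      (mul_le_mul (hbox hq).1.2 (hbox hq).2.2 (hbox hq).2.1.le (hs.le.trans hA))) h4
      (Real.exp_pos _).le (Real.sqrt_nonneg _)) (by positivity) zero_le_one
  -- Fubini reduces the conditioning of the whole integral to conditioning at each point of the box.
  -- Then |φ| ≤ 1 and Cauchy–Schwarz leave a second moment.
  have hcond : ∫ ω, φ ω * ∫ p, levyIntegrand L θ ω p.2 p.1 ∂ν ∂μ =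
      ∫ ω, φ ω * ∫ p, levyIntegrandPast L Ψ θ s t ω p.2 p.1 ∂ν ∂μ := by
    simp_rw [← integral_const_mul]
    refine (integral_integral_swap hfi).trans
      (Eq.trans (integral_congr_ae ?_) (integral_integral_swap hgi).symm)
    filter_upwards [hmem] with p hp
    exact integral_past_mul_levyIntegrand hL hm θ hs ht hp.2.1 hp.1.1 hφ
  have hYm : StronglyMeasurable fun ω => ∫ p, levyIntegrandPast L Ψ θ s t ω p.2 p.1 ∂ν :=
    hg.stronglyMeasurable.integral_prod_right'
  rw [hcond]
  calc _ ≤ (∫⁻ ω, ‖∫ p, levyIntegrandPast L Ψ θ s t ω p.2 p.1 ∂ν‖ₑ ∂μ) ^ 2 := by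
        gcongr
        refine (enorm_integral_le_lintegral_enorm _).trans (lintegral_mono fun ω => ?_)
        rw [enorm_mul]
        refine mul_le_of_le_one_left (zero_le) ?_
        rw [← ofReal_norm, ← ENNReal.ofReal_one]
        exact ENNReal.ofReal_le_ofReal (hφ1 ω)
    _ ≤ ∫⁻ ω, ‖∫ p, levyIntegrandPast L Ψ θ s t ω p.2 p.1 ∂ν‖ₑ ^ 2 ∂μ :=
        sq_lintegral_le hYm.enorm.aemeasurable
    _ ≤ _ := lintegral_enorm_past_sq_le hL hLm ha hs ht hA hB

end Past

/-! ### Estimates for the rescaled field -/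

section Field

variable {Ω : Type*} [m0 : MeasurableSpace Ω] {L : ℝ≥0 → ℝ≥0 → Ω → ℝ} {Ψ : ℝ → ℂ} {μ : Measure Ω}

theorem levyField_eq_box
    (hLm : Measurable fun p : (ℝ≥0 × ℝ≥0) × Ω => L p.1.1 p.1.2 p.2) (Ψ : ℝ → ℂ) (θ : ℝ)
    {ε s t : ℝ} (hε : 0 < ε) (hs : 0 ≤ s) (ht : 0 ≤ t) (ω : Ω) :
    levyField L Ψ θ ε s t ω = (ε : ℂ) * (levyConst Ψ θ : ℂ) *
      ∫ p in Set.Ioc 0 (t / ε) ×ˢ Set.Ioc 0 (s / ε), levyIntegrand L θ ω p.2 p.1 := by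
  rw [levyField, iterated_eq_box hLm θ ω (A := s / ε) (B := t / ε)
    ⟨div_nonneg hs hε.le, le_rfl⟩ ⟨div_nonneg ht hε.le, le_rfl⟩,
    setIntegral_indicator (measurableSet_Ioc.prod measurableSet_Ioc), Set.inter_self]

theorem setIntegral_box_increment {f : ℝ × ℝ → ℂ} {s s' t t' : ℝ} (hs : 0 ≤ s) (hss : s ≤ s')
    (ht : 0 ≤ t) (htt : t ≤ t') (hf : IntegrableOn f (Set.Ioc 0 t' ×ˢ Set.Ioc 0 s')) :
    (∫ p in Set.Ioc 0 t' ×ˢ Set.Ioc 0 s', f p) - (∫ p in Set.Ioc 0 t' ×ˢ Set.Ioc 0 s, f p) -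
      (∫ p in Set.Ioc 0 t ×ˢ Set.Ioc 0 s', f p) + (∫ p in Set.Ioc 0 t ×ˢ Set.Ioc 0 s, f p) =
      ∫ p in Set.Ioc t t' ×ˢ Set.Ioc s s', f p := by
  have hx : ∀ {v : ℝ}, v ≤ t' → ∫ p in Set.Ioc 0 v ×ˢ Set.Ioc 0 s', f p =
      (∫ p in Set.Ioc 0 v ×ˢ Set.Ioc 0 s, f p) + ∫ p in Set.Ioc 0 v ×ˢ Set.Ioc s s', f p := by
    intro v hv
    rw [← setIntegral_union (Set.disjoint_prod.2 (Or.inr (Set.Ioc_disjoint_Ioc_of_le le_rfl)))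
      (measurableSet_Ioc.prod measurableSet_Ioc), ← Set.prod_union, Set.Ioc_union_Ioc_eq_Ioc hs hss]
    · exact hf.mono_set (Set.prod_mono (Set.Ioc_subset_Ioc_right hv) (Set.Ioc_subset_Ioc_right hss))
    · exact hf.mono_set (Set.prod_mono (Set.Ioc_subset_Ioc_right hv) (Set.Ioc_subset_Ioc_left hs))
  have hy : ∫ p in Set.Ioc 0 t' ×ˢ Set.Ioc s s', f p =
      (∫ p in Set.Ioc 0 t ×ˢ Set.Ioc s s', f p) + ∫ p in Set.Ioc t t' ×ˢ Set.Ioc s s', f p := by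
    rw [← setIntegral_union (Set.disjoint_prod.2 (Or.inl (Set.Ioc_disjoint_Ioc_of_le le_rfl)))
      (measurableSet_Ioc.prod measurableSet_Ioc), ← Set.union_prod, Set.Ioc_union_Ioc_eq_Ioc ht htt]
    · exact hf.mono_set (Set.prod_mono (Set.Ioc_subset_Ioc_right htt) (Set.Ioc_subset_Ioc_left hs))
    · exact hf.mono_set (Set.prod_mono (Set.Ioc_subset_Ioc_left ht) (Set.Ioc_subset_Ioc_left hs))
  rw [hx le_rfl, hx htt, hy]
  ring

theorem levyField_increment
    (hLm : Measurable fun p : (ℝ≥0 × ℝ≥0) × Ω => L p.1.1 p.1.2 p.2) (Ψ : ℝ → ℂ) (θ : ℝ)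
    {ε s s' t t' : ℝ} (hε : 0 < ε) (hs : 0 ≤ s) (hss : s ≤ s') (ht : 0 ≤ t) (htt : t ≤ t') (ω : Ω) :
    levyField L Ψ θ ε s' t' ω - levyField L Ψ θ ε s t' ω - levyField L Ψ θ ε s' t ω
      + levyField L Ψ θ ε s t ω = (ε : ℂ) * (levyConst Ψ θ : ℂ) *
      ∫ p in Set.Ioc (t / ε) (t' / ε) ×ˢ Set.Ioc (s / ε) (s' / ε),
        levyIntegrand L θ ω p.2 p.1 := by
  rw [levyField_eq_box hLm Ψ θ hε (hs.trans hss) (ht.trans htt),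
    levyField_eq_box hLm Ψ θ hε hs (ht.trans htt), levyField_eq_box hLm Ψ θ hε (hs.trans hss) ht,
    levyField_eq_box hLm Ψ θ hε hs ht, ← setIntegral_box_increment (div_nonneg hs hε.le)
      (div_le_div_of_nonneg_right hss hε.le) (div_nonneg ht hε.le)
      (div_le_div_of_nonneg_right htt hε.le) (integrableOn_levyIntegrand hLm θ ω _ _)]
  ring

theorem enorm_const_sq (Ψ : ℝ → ℂ) (θ ε : ℝ) :
    ‖(ε : ℂ) * (levyConst Ψ θ : ℂ)‖ₑ ^ 2 = ENNReal.ofReal (ε ^ 2 * levyConst Ψ θ ^ 2) := by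
  rw [← ofReal_norm, ← ENNReal.ofReal_pow (norm_nonneg _), norm_mul, Complex.norm_real,
    Complex.norm_real, mul_pow, Real.norm_eq_abs, Real.norm_eq_abs, sq_abs, sq_abs]

/-- A bound for the second moment of `X_ε(s,t)` that does not depend on `ε`. -/
theorem lintegral_enorm_levyField_sq_le [IsProbabilityMeasure μ] (hL : IsLevySheet L Ψ μ)
    (hLm : Measurable fun p : (ℝ≥0 × ℝ≥0) × Ω => L p.1.1 p.1.2 p.2) {θ : ℝ}
    (ha : 0 < (Ψ θ).re) {ε s t : ℝ} (hε : 0 < ε) (hs : 0 ≤ s) (ht : 0 ≤ t) :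
    ∫⁻ ω, ‖levyField L Ψ θ ε s t ω‖ₑ ^ 2 ∂μ ≤
      ENNReal.ofReal (32 * levyConst Ψ θ ^ 2 / (Ψ θ).re ^ 2 * (s * t)) := by
  simp_rw [levyField_eq_box hLm Ψ θ hε hs ht, enorm_mul _ (∫ p in _, _), mul_pow, enorm_const_sq]
  rw [lintegral_const_mul' _ _ ENNReal.ofReal_ne_top]
  refine (mul_le_mul_right (lintegral_enorm_box_sq_le hL hLm ha (div_nonneg hs hε.le)
    (div_nonneg ht hε.le)) _).trans_eq ?_
  rw [← ENNReal.ofReal_mul (by positivity)]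
  -- The area of the box scales like ε⁻² and cancels the prefactor ε².
  congr 1
  field_simp

theorem aestronglyMeasurable_levyField_sheetPast [IsProbabilityMeasure μ]
    (hLm : Measurable fun p : (ℝ≥0 × ℝ≥0) × Ω => L p.1.1 p.1.2 p.2) (Ψ : ℝ → ℂ) (θ : ℝ)
    {ε s t u v : ℝ} (hε : 0 < ε) (hu : 0 ≤ u) (hv : 0 ≤ v) (h : u ≤ s ∨ v ≤ t) :
    AEStronglyMeasurable[sheetPast L (s / ε).toNNReal (t / ε).toNNReal]
      (levyField L Ψ θ ε u v) μ := by
  rw [funext (levyField_eq_box hLm Ψ θ hε hu hv)]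
  refine aestronglyMeasurable_const.mul (aestronglyMeasurable_box_sheetPast hLm θ ?_)
  exact h.imp
    (fun h => (div_le_div_of_nonneg_right h hε.le).trans (Real.le_coe_toNNReal _))
    (fun h => (div_le_div_of_nonneg_right h hε.le).trans (Real.le_coe_toNNReal _))

/-- The increments of `X_ε` are asymptotically orthogonal to the past. -/
theorem enorm_integral_past_mul_increment_sq_le [IsProbabilityMeasure μ] (hL : IsLevySheet L Ψ μ)
    (hLm : Measurable fun p : (ℝ≥0 × ℝ≥0) × Ω => L p.1.1 p.1.2 p.2) {θ : ℝ}
    (ha : 0 < (Ψ θ).re) {ε s s' t t' : ℝ} (hε : 0 < ε) (hs : 0 < s) (hss : s ≤ s') (ht : 0 < t)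
    (htt : t ≤ t') {φ : Ω → ℂ}
    (hφ : AEStronglyMeasurable[sheetPast L (s / ε).toNNReal (t / ε).toNNReal] φ μ)
    (hφ1 : ∀ ω, ‖φ ω‖ ≤ 1) :
    ‖∫ ω, φ ω * (levyField L Ψ θ ε s' t' ω - levyField L Ψ θ ε s t' ω - levyField L Ψ θ ε s' t ω
      + levyField L Ψ θ ε s t ω) ∂μ‖ₑ ^ 2 ≤
      ENNReal.ofReal (16 * levyConst Ψ θ ^ 2 * (s' * t') /
        ((Ψ θ).re ^ 2 * s * t * Real.sqrt (Ψ θ).re) * Real.sqrt ((s' - s) * (t' - t)) * ε) := by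
  simp_rw [levyField_increment hLm Ψ θ hε hs.le hss ht.le htt,
    mul_left_comm _ ((ε : ℂ) * (levyConst Ψ θ : ℂ))]
  rw [integral_const_mul, enorm_mul _ (∫ ω, _ ∂μ), mul_pow, enorm_const_sq]
  refine (mul_le_mul_right (enorm_integral_past_mul_sq_le hL hLm ha (div_pos hs hε)
    (div_pos ht hε) (div_le_div_of_nonneg_right hss hε.le) (div_le_div_of_nonneg_right htt hε.le)
    hφ hφ1) _).trans_eq ?_
  rw [← ENNReal.ofReal_mul (by positivity)]
  congr 1
  -- Scaling count: s't' and 1/(st) contribute ε⁻² and ε², this root contributes ε⁻¹, and the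
  -- prefactor ε² leaves a single ε.
  have h1 : Real.sqrt ((s' / ε - s / ε) * (t' / ε - t / ε)) =
      Real.sqrt ((s' - s) * (t' - t)) / ε := by
    rw [← sub_div, ← sub_div, div_mul_div_comm, Real.sqrt_div' _ (by positivity),
      Real.sqrt_mul_self hε.le]
  rw [h1]
  field_simp

end Field

/-! ### Passing to the limit under L² bounds -/

section WeakLimits

/-- Truncation at level `M`. -/
noncomputable def symmClamp (M x : ℝ) : ℝ := max (-M) (min x M)

theorem continuous_symmClamp (M : ℝ) : Continuous (symmClamp M) := by
  unfold symmClamp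
  fun_prop

theorem abs_symmClamp_le {M : ℝ} (hM : 0 ≤ M) (x : ℝ) : |symmClamp M x| ≤ M :=
  abs_le.2 ⟨le_max_left _ _, max_le (by linarith) (min_le_right _ _)⟩

/-- The error vanishes unless |x| > M, where |x| ≤ x²/M. An L² bound C thus controls the mean
truncation error by C/M, uniformly over a family. -/
theorem abs_sub_symmClamp_le {M : ℝ} (hM : 0 < M) (x : ℝ) : |x - symmClamp M x| ≤ x ^ 2 / M := by
  rw [le_div_iff₀ hM, symmClamp]
  rcases le_total x M with h | h
  · rw [min_eq_left h]
    rcases le_total (-M) x with h' | h'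
    · rw [max_eq_right h']
      simp [sq_nonneg]
    · rw [max_eq_left h', abs_of_nonpos (by linarith)]
      nlinarith
  · rw [min_eq_right h, max_eq_right (by linarith), abs_of_nonneg (by linarith)]
    nlinarith

variable {E : Type*} [MeasurableSpace E]

theorem integrable_sq_of_lintegral_le {Q : Measure E} {f : E → ℝ} {C : ℝ} (hC : 0 ≤ C)
    (hf : Measurable f) (h : ∫⁻ x, ‖f x‖ₑ ^ 2 ∂Q ≤ ENNReal.ofReal C) :
    Integrable (fun x => f x ^ 2) Q ∧ ∫ x, f x ^ 2 ∂Q ≤ C := by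
  have h1 : ∀ x, ‖f x‖ₑ ^ 2 = ENNReal.ofReal (f x ^ 2) := fun x => by
    rw [← ofReal_norm, ← ENNReal.ofReal_pow (norm_nonneg _), Real.norm_eq_abs, sq_abs]
  simp_rw [h1] at h
  have hi : Integrable (fun x => f x ^ 2) Q := by
    refine ⟨(hf.pow_const 2).aestronglyMeasurable, ?_⟩
    rw [hasFiniteIntegral_iff_ofReal (ae_of_all _ fun x => sq_nonneg _)]
    exact h.trans_lt ENNReal.ofReal_lt_top
  refine ⟨hi, ?_⟩
  rw [← ofReal_integral_eq_lintegral_ofReal hi (ae_of_all _ fun x => sq_nonneg _)] at h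
  exact (ENNReal.ofReal_le_ofReal_iff hC).1 h

theorem integrable_of_lintegral_sq_le {Q : Measure E} [IsFiniteMeasure Q] {f : E → ℝ} {C : ℝ}
    (hC : 0 ≤ C) (hf : Measurable f) (h : ∫⁻ x, ‖f x‖ₑ ^ 2 ∂Q ≤ ENNReal.ofReal C) :
    Integrable f Q := by
  refine ((integrable_sq_of_lintegral_le hC hf h).1.add (integrable_const 1)).mono'
    hf.aestronglyMeasurable (ae_of_all _ fun x => ?_)
  rw [Real.norm_eq_abs, Pi.add_apply, ← sq_abs]
  nlinarith [sq_nonneg (|f x| - 1)]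

theorem abs_integral_sub_symmClamp_le {Q : Measure E} [IsFiniteMeasure Q] {f ψ : E → ℝ} {C M : ℝ}
    (hC : 0 ≤ C) (hM : 0 < M) (hf : Measurable f) (h : ∫⁻ x, ‖f x‖ₑ ^ 2 ∂Q ≤ ENNReal.ofReal C)
    (hψ : Measurable ψ) (hψ1 : ∀ x, |ψ x| ≤ 1) :
    |∫ x, ψ x * f x ∂Q - ∫ x, ψ x * symmClamp M (f x) ∂Q| ≤ C / M := by
  obtain ⟨hi, hiC⟩ := integrable_sq_of_lintegral_le hC hf h
  have hfi := integrable_of_lintegral_sq_le hC hf h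
  have hti : Integrable (fun x => symmClamp M (f x)) Q :=
    Integrable.of_bound ((continuous_symmClamp M).measurable.comp hf).aestronglyMeasurable M
      (ae_of_all _ fun x => abs_symmClamp_le hM.le _)
  have hψb : ∀ᵐ x ∂Q, ‖ψ x‖ ≤ 1 := ae_of_all _ hψ1
  rw [← integral_sub (hfi.bdd_mul hψ.aestronglyMeasurable hψb)
    (hti.bdd_mul hψ.aestronglyMeasurable hψb), ← Real.norm_eq_abs]
  calc _ ≤ ∫ x, f x ^ 2 / M ∂Q := by
        refine norm_integral_le_of_norm_le (hi.div_const M) (ae_of_all _ fun x => ?_)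
        rw [← mul_sub, norm_mul]
        calc ‖ψ x‖ * ‖f x - symmClamp M (f x)‖ ≤ 1 * (f x ^ 2 / M) :=
              mul_le_mul (hψ1 x) (abs_sub_symmClamp_le hM _) (norm_nonneg _) zero_le_one
          _ = _ := one_mul _
    _ = (∫ x, f x ^ 2 ∂Q) / M := integral_div _ _
    _ ≤ C / M := by gcongr

/-- At level M the truncated limit J satisfies |J| ≤ C/M because u tends to 0, so |I| ≤ 2C/M; then M
→ ∞. This step is shared by the weak and the pointwise limits. -/
theorem eq_zero_of_forall_symmClamp {C I : ℝ} {u : ℕ → ℝ} (hu : Tendsto u atTop (𝓝 0))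
    (h : ∀ M : ℝ, 0 < M → ∃ (J : ℝ) (v : ℕ → ℝ), Tendsto v atTop (𝓝 J) ∧ |I - J| ≤ C / M ∧
      ∀ n, |u n - v n| ≤ C / M) : I = 0 := by
  have key : ∀ M : ℝ, 0 < M → |I| ≤ 2 * C / M := by
    intro M hM
    obtain ⟨J, v, hv, hIJ, huv⟩ := h M hM
    have h1 : |0 - J| ≤ C / M :=
      le_of_tendsto' ((hu.sub hv).abs) huv
    have h2 := abs_sub_abs_le_abs_sub I J
    rw [zero_sub, abs_neg] at h1
    rw [mul_div_assoc]
    linarith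
  have h0 : Tendsto (fun M : ℝ => 2 * C / M) atTop (𝓝 0) :=
    tendsto_const_nhds.div_atTop tendsto_id
  have h1 : |I| ≤ 0 := ge_of_tendsto h0 ((eventually_gt_atTop 0).mono key)
  exact abs_eq_zero.1 (le_antisymm h1 (abs_nonneg _))

/-- Pointwise limits of functions bounded in `L²` inherit vanishing integrals. -/
theorem setIntegral_eq_zero_of_tendsto {Q : Measure E} [IsFiniteMeasure Q] {f : ℕ → E → ℝ}
    {g : E → ℝ} {C : ℝ} (hC : 0 ≤ C) (hf : ∀ n, Measurable (f n)) (hg : Measurable g)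
    (hfC : ∀ n, ∫⁻ x, ‖f n x‖ₑ ^ 2 ∂Q ≤ ENNReal.ofReal C)
    (hgC : ∫⁻ x, ‖g x‖ₑ ^ 2 ∂Q ≤ ENNReal.ofReal C)
    (hfg : ∀ x, Tendsto (fun n => f n x) atTop (𝓝 (g x))) {A : Set E} (hA : MeasurableSet A)
    (h : ∀ n, ∫ x in A, f n x ∂Q = 0) : ∫ x in A, g x ∂Q = 0 := by
  set ψ : E → ℝ := A.indicator fun _ => 1 with hψ
  have hψm : Measurable ψ := measurable_const.indicator hA
  have hψ1 : ∀ x, |ψ x| ≤ 1 := fun x => by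
    by_cases hx : x ∈ A <;> simp [hψ, hx]
  have hψA : ∀ k : E → ℝ, ∫ x in A, k x ∂Q = ∫ x, ψ x * k x ∂Q := fun k => by
    rw [← integral_indicator hA]
    congr 1 with x
    by_cases hx : x ∈ A <;> simp [hψ, hx]
  rw [hψA]
  refine eq_zero_of_forall_symmClamp (C := C) (u := fun n => ∫ x, ψ x * f n x ∂Q) ?_ ?_
  · simp_rw [← hψA, h]
    exact tendsto_const_nhds
  · intro M hM
    refine ⟨∫ x, ψ x * symmClamp M (g x) ∂Q, fun n => ∫ x, ψ x * symmClamp M (f n x) ∂Q, ?_,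
      abs_integral_sub_symmClamp_le hC hM hg hgC hψm hψ1,
      fun n => abs_integral_sub_symmClamp_le hC hM (hf n) (hfC n) hψm hψ1⟩
    refine tendsto_integral_of_dominated_convergence (fun _ => 1 * M) (fun n => ?_)
      (integrable_const _) (fun n => ae_of_all _ fun x => ?_) (ae_of_all _ fun x => ?_)
    · exact (hψm.mul ((continuous_symmClamp M).measurable.comp (hf n))).aestronglyMeasurable
    · rw [norm_mul]
      exact mul_le_mul (hψ1 x) (abs_symmClamp_le hM.le _) (norm_nonneg _) zero_le_one
    · exact (((continuous_symmClamp M).tendsto _).comp (hfg x)).const_mul _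

variable [TopologicalSpace E] [OpensMeasurableSpace E] [HasOuterApproxClosed E]

/-- A Fatou inequality for weak convergence, derived from the portmanteau bound on open sets. -/
theorem lintegral_sq_le_of_tendsto {P : ProbabilityMeasure E} {Pn : ℕ → ProbabilityMeasure E}
    (hP : Tendsto Pn atTop (𝓝 P)) {f : E → ℝ} (hf : Continuous f) {C : ENNReal}
    (h : ∀ n, ∫⁻ x, ‖f x‖ₑ ^ 2 ∂(Pn n : Measure E) ≤ C) :
    ∫⁻ x, ‖f x‖ₑ ^ 2 ∂(P : Measure E) ≤ C := by
  have h1 : ∀ x, ‖f x‖ₑ ^ 2 = ENNReal.ofReal (f x ^ 2) := fun x => by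
    rw [← ofReal_norm, ← ENNReal.ofReal_pow (norm_nonneg _), Real.norm_eq_abs, sq_abs]
  simp_rw [h1] at h ⊢
  refine (lintegral_le_liminf_lintegral_of_forall_isOpen_measure_le_liminf_measure
    (μs := fun n => (Pn n : Measure E)) (hf.pow 2) (fun x => sq_nonneg _) fun G hG =>
      ProbabilityMeasure.le_liminf_measure_open_of_tendsto hP hG).trans ?_
  exact liminf_le_of_le (by isBoundedDefault) fun b hb =>
    let ⟨n, hn⟩ := hb.exists
    hn.trans (h n)

/-- Convergence of integrals of functions bounded in `L²` under weak convergence. -/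
theorem integral_mul_eq_zero_of_tendsto {P : ProbabilityMeasure E} {Pn : ℕ → ProbabilityMeasure E}
    (hP : Tendsto Pn atTop (𝓝 P)) {f φ : E → ℝ} (hf : Continuous f) {C : ℝ} (hC : 0 ≤ C)
    (hfC : ∀ n, ∫⁻ x, ‖f x‖ₑ ^ 2 ∂(Pn n : Measure E) ≤ ENNReal.ofReal C) (hφ : Continuous φ)
    (hφ1 : ∀ x, |φ x| ≤ 1)
    (h : Tendsto (fun n => ∫ x, φ x * f x ∂(Pn n : Measure E)) atTop (𝓝 0)) :
    ∫ x, φ x * f x ∂(P : Measure E) = 0 := by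
  refine eq_zero_of_forall_symmClamp (C := C) h fun M hM => ?_
  refine ⟨∫ x, φ x * symmClamp M (f x) ∂(P : Measure E),
    fun n => ∫ x, φ x * symmClamp M (f x) ∂(Pn n : Measure E), ?_,
    abs_integral_sub_symmClamp_le hC hM hf.measurable (lintegral_sq_le_of_tendsto hP hf hfC)
      hφ.measurable hφ1,
    fun n => abs_integral_sub_symmClamp_le hC hM hf.measurable (hfC n) hφ.measurable hφ1⟩
  exact ProbabilityMeasure.tendsto_iff_forall_integral_tendsto.1 hP
    (BoundedContinuousFunction.ofNormedAddCommGroup (fun x => φ x * symmClamp M (f x))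
      (hφ.mul ((continuous_symmClamp M).comp hf)) (1 * M) fun x => by
        rw [norm_mul]
        exact mul_le_mul (hφ1 x) (abs_symmClamp_le hM.le _) (norm_nonneg _) zero_le_one)

end WeakLimits

/-! ### Increments and cylinder sets on the path space -/

section PathSpace

variable {S T : ℝ}

/-- The increment of a path over a rectangle. -/
noncomputable def pathIncrement (s s' : Set.Icc (0 : ℝ) S) (t t' : Set.Icc (0 : ℝ) T) (w : PathSpace S T) : ℂ :=
  w (s', t') - w (s, t') - w (s', t) + w (s, t)

theorem continuous_pathIncrement (s s' : Set.Icc (0 : ℝ) S) (t t' : Set.Icc (0 : ℝ) T) :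
    Continuous (pathIncrement s s' t t') := by
  unfold pathIncrement
  fun_prop

theorem rectIncrement_eq (ρ : ℂ →L[ℝ] ℝ) (s s' : Set.Icc (0 : ℝ) S) (t t' : Set.Icc (0 : ℝ) T) :
    rectIncrement (fun z (w : PathSpace S T) => ρ (canonicalProcess z w)) s s' t t' =
      fun w => ρ (pathIncrement s s' t t' w) := by
  funext w
  simp [rectIncrement, pathIncrement, canonicalProcess]

theorem enorm_apply_increment_sq_le {ρ : ℂ →L[ℝ] ℝ} (hρ : ∀ x, |ρ x| ≤ ‖x‖) (a b c d : ℂ) :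
    ‖ρ (a - b - c + d)‖ₑ ^ 2 ≤ 4 * (‖a‖ₑ ^ 2 + ‖b‖ₑ ^ 2 + ‖c‖ₑ ^ 2 + ‖d‖ₑ ^ 2) := by
  have h1 : |ρ (a - b - c + d)| ≤ ‖a‖ + ‖b‖ + ‖c‖ + ‖d‖ := by
    refine (hρ _).trans ((norm_add_le _ _).trans ?_)
    have h2 := norm_sub_le (a - b) c
    have h3 := norm_sub_le a b
    linarith
  have h2 : |ρ (a - b - c + d)| ^ 2 ≤ 4 * (‖a‖ ^ 2 + ‖b‖ ^ 2 + ‖c‖ ^ 2 + ‖d‖ ^ 2) := by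
    refine (pow_le_pow_left₀ (abs_nonneg _) h1 2).trans ?_
    nlinarith [sq_nonneg (‖a‖ - ‖b‖), sq_nonneg (‖a‖ - ‖c‖), sq_nonneg (‖a‖ - ‖d‖),
      sq_nonneg (‖b‖ - ‖c‖), sq_nonneg (‖b‖ - ‖d‖), sq_nonneg (‖c‖ - ‖d‖)]
  have h3 := ENNReal.ofReal_le_ofReal h2
  rw [ENNReal.ofReal_mul (by norm_num), ENNReal.ofReal_add (by positivity) (by positivity),
    ENNReal.ofReal_add (by positivity) (by positivity),
    ENNReal.ofReal_add (by positivity) (by positivity)] at h3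
  simpa only [← Real.norm_eq_abs, ENNReal.ofReal_pow (norm_nonneg _), ofReal_norm,
    ENNReal.ofReal_ofNat] using h3

theorem lintegral_enorm_pathIncrement_sq_le {ρ : ℂ →L[ℝ] ℝ} (hρ : ∀ x, |ρ x| ≤ ‖x‖)
    {Q : Measure (PathSpace S T)} {C : ℝ}
    (hQ : ∀ z, ∫⁻ w, ‖w z‖ₑ ^ 2 ∂Q ≤ ENNReal.ofReal C)
    (s s' : Set.Icc (0 : ℝ) S) (t t' : Set.Icc (0 : ℝ) T) :
    ∫⁻ w, ‖ρ (pathIncrement s s' t t' w)‖ₑ ^ 2 ∂Q ≤ ENNReal.ofReal (16 * C) := by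
  have hm : ∀ z : ParamRect S T, Measurable fun w : PathSpace S T => ‖w z‖ₑ ^ 2 := fun z => by
    have hc : Continuous fun w : PathSpace S T => w z := by fun_prop
    exact hc.measurable.enorm.pow_const 2
  calc ∫⁻ w, ‖ρ (pathIncrement s s' t t' w)‖ₑ ^ 2 ∂Q
      ≤ ∫⁻ w, 4 * (‖w (s', t')‖ₑ ^ 2 + ‖w (s, t')‖ₑ ^ 2 + ‖w (s', t)‖ₑ ^ 2 + ‖w (s, t)‖ₑ ^ 2) ∂Q :=
        lintegral_mono fun w => enorm_apply_increment_sq_le hρ _ _ _ _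
    _ = 4 * (∫⁻ w, ‖w (s', t')‖ₑ ^ 2 ∂Q + ∫⁻ w, ‖w (s, t')‖ₑ ^ 2 ∂Q + ∫⁻ w, ‖w (s', t)‖ₑ ^ 2 ∂Q
          + ∫⁻ w, ‖w (s, t)‖ₑ ^ 2 ∂Q) := by
        rw [lintegral_const_mul' _ _ (by norm_num), lintegral_add_right _ (hm _),
          lintegral_add_right _ (hm _), lintegral_add_right _ (hm _)]
    _ ≤ 4 * (ENNReal.ofReal C + ENNReal.ofReal C + ENNReal.ofReal C + ENNReal.ofReal C) :=
        mul_le_mul_right (add_le_add (add_le_add (add_le_add (hQ _) (hQ _)) (hQ _)) (hQ _)) _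
    _ = ENNReal.ofReal (16 * C) := by
        rw [ENNReal.ofReal_mul (by norm_num), ENNReal.ofReal_ofNat]
        ring

/-- Finite intersections of closed conditions on the values of a path at points of `Z`. -/
def closedCylinders (Z : Set (ParamRect S T)) : Set (Set (PathSpace S T)) :=
  piiUnionInter (fun z => {A | ∃ C : Set ℂ, IsClosed C ∧ canonicalProcess z ⁻¹' C = A}) Z

theorem isPiSystem_closedCylinders (Z : Set (ParamRect S T)) : IsPiSystem (closedCylinders Z) := by
  refine isPiSystem_piiUnionInter _ (fun z => ?_) Z
  rintro _ ⟨C, hC, rfl⟩ _ ⟨D, hD, rfl⟩ -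
  exact ⟨C ∩ D, hC.inter hD, rfl⟩

theorem comap_canonicalProcess_le {Z : Set (ParamRect S T)} {z : ParamRect S T} (hz : z ∈ Z) :
    MeasurableSpace.comap (canonicalProcess z) (borel ℂ) ≤
      MeasurableSpace.generateFrom (closedCylinders Z) := by
  rw [borel_eq_generateFrom_isClosed, MeasurableSpace.comap_generateFrom]
  refine MeasurableSpace.generateFrom_mono ?_
  rintro _ ⟨C, hC, rfl⟩
  exact subset_piiUnionInter hz ⟨C, hC, rfl⟩

theorem canonicalFiltration_le {Z : Set (ParamRect S T)} {i : ParamRect S T}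
    (hi : ∀ z ≤ i, z ∈ Z) :
    canonicalFiltration S T i ≤ MeasurableSpace.generateFrom (closedCylinders Z) := by
  refine iSup₂_le fun z hz => ?_
  have := comap_canonicalProcess_le (hi z hz)
  rwa [← BorelSpace.measurable_eq (α := ℂ)] at this

theorem generateFrom_closedCylinders_le (Z : Set (ParamRect S T)) :
    MeasurableSpace.generateFrom (closedCylinders Z) ≤ pathSpaceMeasurableSpace S T := by
  refine generateFrom_piiUnionInter_le _ (fun z => MeasurableSpace.generateFrom_le ?_) Z
  rintro _ ⟨C, hC, rfl⟩
  exact (stronglyMeasurable_canonicalProcess z).measurable hC.measurableSet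

/-- A random variable that integrates to zero against products of continuous functions of the
values of the path at points of `Z` integrates to zero over the σ-algebra they generate. -/
theorem setIntegral_eq_zero_of_closedCylinders {P : Measure (PathSpace S T)} [IsFiniteMeasure P]
    {R : PathSpace S T → ℝ} (hR : Integrable R P) (Z : Set (ParamRect S T))
    (h : ∀ (F : Finset (ParamRect S T)) (g : ParamRect S T → ℂ → ℝ), ↑F ⊆ Z →
      (∀ z, Continuous (g z)) → (∀ z x, 0 ≤ g z x) → (∀ z x, g z x ≤ 1) →
      ∫ w, (∏ z ∈ F, g z (w z)) * R w ∂P = 0)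
    {A : Set (PathSpace S T)}
    (hA : MeasurableSet[MeasurableSpace.generateFrom (closedCylinders Z)] A) :
    ∫ w in A, R w ∂P = 0 := by
  -- The empty product gives the total integral, which the complement step of the π-λ induction
  -- needs.
  have huniv : ∫ w, R w ∂P = 0 := by
    simpa using h ∅ (fun _ _ => 1) (by simp) (fun _ => continuous_const) (by simp) (by simp)
  have hle := generateFrom_closedCylinders_le Z
  induction A, hA using MeasurableSpace.induction_on_inter rfl (isPiSystem_closedCylinders Z) with
  | empty => simp
  | basic A hA =>
    obtain ⟨F, hF, f, hf, rfl⟩ := hA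
    choose! C hC hCf using hf
    have hset : ⋂ z ∈ F, f z = {w : PathSpace S T | ∀ z ∈ F, w z ∈ C z} := by
      ext w
      simp only [Set.mem_iInter, Set.mem_ofPred_eq]
      exact forall₂_congr fun z hz => by rw [← hCf z hz]; rfl
    have hmeas : MeasurableSet {w : PathSpace S T | ∀ z ∈ F, w z ∈ C z} := by
      rw [← hset]
      refine F.measurableSet_biInter fun z hz => ?_
      rw [← hCf z hz]
      exact (stronglyMeasurable_canonicalProcess z).measurable (hC z hz).measurableSet
    rw [hset, ← integral_indicator hmeas]
    have hδ : ∀ k : ℕ, (0 : ℝ) < 1 / ((k : ℝ) + 1) := fun k => by positivity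
    -- Thickened indicators are continuous with values in [0,1] and converge to the indicator of the
    -- closure, which is `C z` itself. This is why the cylinders are taken over closed sets.
    set g : ℕ → ParamRect S T → ℂ → ℝ := fun k z x => thickenedIndicator (hδ k) (C z) x with hg
    have hg0 : ∀ k z x, 0 ≤ g k z x := fun k z x => NNReal.coe_nonneg _
    have hg1 : ∀ k z x, g k z x ≤ 1 := fun k z x =>
      NNReal.coe_le_one.2 (thickenedIndicator_le_one (hδ k) (C z) x)
    have hgc : ∀ k z, Continuous (g k z) := fun k z =>
      NNReal.continuous_coe.comp (thickenedIndicator (hδ k) (C z)).continuous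
    have hlim : Tendsto (fun k => ∫ w, (∏ z ∈ F, g k z (w z)) * R w ∂P) atTop
        (𝓝 (∫ w, {w : PathSpace S T | ∀ z ∈ F, w z ∈ C z}.indicator R w ∂P)) := by
      refine tendsto_integral_of_dominated_convergence (fun w => ‖R w‖) (fun k => ?_) hR.norm
        (fun k => ae_of_all _ fun w => ?_) (ae_of_all _ fun w => ?_)
      · refine (Continuous.aestronglyMeasurable ?_).mul hR.aestronglyMeasurable
        exact continuous_finsetProd _ fun z _ => (hgc k z).comp (by fun_prop)
      · rw [norm_mul]
        refine mul_le_of_le_one_left (norm_nonneg _) ?_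
        rw [Real.norm_of_nonneg (Finset.prod_nonneg fun z _ => hg0 k z _)]
        exact Finset.prod_le_one (fun z _ => hg0 k z _) fun z _ => hg1 k z _
      · have h1 : ∀ z ∈ F, Tendsto (fun k => g k z (w z)) atTop
            (𝓝 ((C z).indicator (fun _ => (1 : ℝ)) (w z))) := by
          intro z hz
          have h2 := tendsto_pi_nhds.1 (thickenedIndicator_tendsto_indicator_closure hδ
            tendsto_one_div_add_atTop_nhds_zero_nat (C z)) (w z)
          rw [(hC z hz).closure_eq] at h2
          have h3 := (NNReal.continuous_coe.tendsto _).comp h2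
          convert! h3 using 2
          by_cases hw : w z ∈ C z <;> simp [hw]
        have h4 := (tendsto_finsetProd F h1).mul_const (R w)
        convert! h4 using 2
        by_cases hw : ∀ z ∈ F, w z ∈ C z
        · rw [Set.indicator_of_mem (show w ∈ {w : PathSpace S T | ∀ z ∈ F, w z ∈ C z} from hw),
            Finset.prod_congr rfl fun z hz => Set.indicator_of_mem (hw z hz) _]
          simp
        · rw [Set.indicator_of_notMem
            (show w ∉ {w : PathSpace S T | ∀ z ∈ F, w z ∈ C z} from hw)]
          push Not at hw
          obtain ⟨z, hz, hzw⟩ := hw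
          rw [Finset.prod_eq_zero hz (Set.indicator_of_notMem hzw _), zero_mul]
    refine tendsto_nhds_unique hlim ?_
    simp_rw [fun k => h F (g k) hF (hgc k) (hg0 k) (hg1 k)]
    exact tendsto_const_nhds
  | compl A hA ih =>
    rw [setIntegral_compl (hle _ hA) hR, huniv, ih, sub_zero]
  | iUnion f hd hm ih =>
    rw [integral_iUnion (fun i => hle _ (hm i)) hd hR.integrableOn]
    simp [ih]

end PathSpace

/-- `Finset.aestronglyMeasurable_fun_prod`, relative to a sub-σ-algebra. -/
theorem aestronglyMeasurable_finsetProd_of_forall {Ω ι : Type*} {m m0 : MeasurableSpace Ω}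
    {μ : Measure Ω} {F : Finset ι} {f : ι → Ω → ℝ}
    (h : ∀ i ∈ F, AEStronglyMeasurable[m] (f i) μ) :
    AEStronglyMeasurable[m] (fun ω => ∏ i ∈ F, f i ω) μ := by
  induction F using Finset.cons_induction with
  | empty => simpa using aestronglyMeasurable_const
  | cons i F hi ih =>
    simp_rw [Finset.prod_cons]
    exact (h i (Finset.mem_cons_self i F)).mul (ih fun j hj => h j (Finset.mem_cons_of_mem hj))

/-! ### Moment bounds and asymptotic orthogonality under the laws of X_ε -/

section LevyLaw

variable {Ω : Type*} [m0 : MeasurableSpace Ω] {L : ℝ≥0 → ℝ≥0 → Ω → ℝ} {Ψ : ℝ → ℂ}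
  {μ : ProbabilityMeasure Ω} {S T : ℝ}

theorem levyLaw_toMeasure (hLm : Measurable fun p : (ℝ≥0 × ℝ≥0) × Ω => L p.1.1 p.1.2 p.2)
    (Ψ : ℝ → ℂ) (θ : ℝ) {ε : ℝ} (hε : 0 < ε) :
    (levyLaw μ hLm Ψ θ S T hε : Measure (PathSpace S T)) =
      (μ : Measure Ω).map (levyPath hLm Ψ θ S T hε) := rfl

theorem lintegral_levyLaw_enorm_sq_le (hL : IsLevySheet L Ψ (μ : Measure Ω))
    (hLm : Measurable fun p : (ℝ≥0 × ℝ≥0) × Ω => L p.1.1 p.1.2 p.2) {θ : ℝ}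
    (ha : 0 < (Ψ θ).re) {ε : ℝ} (hε : 0 < ε) (z : ParamRect S T) :
    ∫⁻ w, ‖w z‖ₑ ^ 2 ∂(levyLaw μ hLm Ψ θ S T hε : Measure (PathSpace S T)) ≤
      ENNReal.ofReal (32 * levyConst Ψ θ ^ 2 / (Ψ θ).re ^ 2 * (S * T)) := by
  have hc : Continuous fun w : PathSpace S T => w z := by fun_prop
  rw [levyLaw_toMeasure, lintegral_map (hc.measurable.enorm.pow_const 2)
    (measurable_levyPath hLm Ψ θ S T hε)]
  refine (lintegral_enorm_levyField_sq_le hL hLm ha hε z.1.2.1 z.2.2.1).trans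
    (ENNReal.ofReal_le_ofReal ?_)
  have := mul_le_mul z.1.2.2 z.2.2.2 z.2.2.1 (z.1.2.1.trans z.1.2.2)
  gcongr

theorem lintegral_levyLaw_increment_sq_le (hL : IsLevySheet L Ψ (μ : Measure Ω))
    (hLm : Measurable fun p : (ℝ≥0 × ℝ≥0) × Ω => L p.1.1 p.1.2 p.2) {θ : ℝ}
    (ha : 0 < (Ψ θ).re) {ρ : ℂ →L[ℝ] ℝ} (hρ : ∀ x, |ρ x| ≤ ‖x‖) {ε : ℝ} (hε : 0 < ε)
    (s s' : Set.Icc (0 : ℝ) S) (t t' : Set.Icc (0 : ℝ) T) :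
    ∫⁻ w, ‖ρ (pathIncrement s s' t t' w)‖ₑ ^ 2
        ∂(levyLaw μ hLm Ψ θ S T hε : Measure (PathSpace S T)) ≤
      ENNReal.ofReal (16 * (32 * levyConst Ψ θ ^ 2 / (Ψ θ).re ^ 2 * (S * T))) :=
  lintegral_enorm_pathIncrement_sq_le hρ
    (fun z => lintegral_levyLaw_enorm_sq_le hL hLm ha hε z) s s' t t'

/-- Pulled back to Ω, the test product is measurable, up to null sets, for the past of the sheet and
bounded by 1. The squared expectation is then at most cε, with c finite because s and t are
positive. -/
theorem tendsto_integral_levyLaw_increment (hL : IsLevySheet L Ψ (μ : Measure Ω))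
    (hLm : Measurable fun p : (ℝ≥0 × ℝ≥0) × Ω => L p.1.1 p.1.2 p.2) {θ : ℝ}
    (ha : 0 < (Ψ θ).re) {ρ : ℂ →L[ℝ] ℝ} (hρ : ∀ x, |ρ x| ≤ ‖x‖) {ε : ℕ → ℝ} (hε : ∀ n, 0 < ε n)
    (hε0 : Tendsto ε atTop (𝓝 0)) {s s' : Set.Icc (0 : ℝ) S} {t t' : Set.Icc (0 : ℝ) T}
    (hs : 0 < (s : ℝ)) (ht : 0 < (t : ℝ)) (hss : s ≤ s') (htt : t ≤ t')
    {F : Finset (ParamRect S T)} (hF : ∀ z ∈ F, z.1 ≤ s ∨ z.2 ≤ t)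
    {g : ParamRect S T → ℂ → ℝ} (hg : ∀ z, Continuous (g z)) (hg0 : ∀ z x, 0 ≤ g z x)
    (hg1 : ∀ z x, g z x ≤ 1) :
    Tendsto (fun n => ∫ w, (∏ z ∈ F, g z (w z)) * ρ (pathIncrement s s' t t' w)
      ∂(levyLaw μ hLm Ψ θ S T (hε n) : Measure (PathSpace S T))) atTop (𝓝 0) := by
  set c : ℝ := 16 * levyConst Ψ θ ^ 2 * (s' * t') /
    ((Ψ θ).re ^ 2 * s * t * Real.sqrt (Ψ θ).re) * Real.sqrt ((s' - s) * (t' - t)) with hc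
  have hc0 : 0 ≤ c := by
    have h1 : (0 : ℝ) ≤ s' * t' := mul_nonneg s'.2.1 t'.2.1
    positivity
  have hbound : ∀ n, |∫ w, (∏ z ∈ F, g z (w z)) * ρ (pathIncrement s s' t t' w)
      ∂(levyLaw μ hLm Ψ θ S T (hε n) : Measure (PathSpace S T))| ≤ Real.sqrt (c * ε n) := by
    intro n
    have hcont : Continuous fun w : PathSpace S T =>
        (∏ z ∈ F, g z (w z)) * ρ (pathIncrement s s' t t' w) :=
      (continuous_finsetProd _ fun z _ => (hg z).comp (by fun_prop)).mul
        (ρ.continuous.comp (continuous_pathIncrement s s' t t'))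
    rw [levyLaw_toMeasure, integral_map (measurable_levyPath hLm Ψ θ S T (hε n)).aemeasurable
      hcont.aestronglyMeasurable]
    set φ : Ω → ℂ := fun ω => ((∏ z ∈ F, g z (levyField L Ψ θ (ε n) z.1 z.2 ω) : ℝ) : ℂ) with hφ
    set D : Ω → ℂ := fun ω => levyField L Ψ θ (ε n) s' t' ω - levyField L Ψ θ (ε n) s t' ω -
      levyField L Ψ θ (ε n) s' t ω + levyField L Ψ θ (ε n) s t ω with hD
    have hDm : Measurable D :=
      (((measurable_levyField hLm Ψ θ (hε n) s'.2.1 t'.2.1).sub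
        (measurable_levyField hLm Ψ θ (hε n) s.2.1 t'.2.1)).sub
        (measurable_levyField hLm Ψ θ (hε n) s'.2.1 t.2.1)).add
        (measurable_levyField hLm Ψ θ (hε n) s.2.1 t.2.1)
    have hφm : AEStronglyMeasurable[sheetPast L (s / ε n).toNNReal (t / ε n).toNNReal] φ
        (μ : Measure Ω) := by
      refine Complex.continuous_ofReal.comp_aestronglyMeasurable ?_
      exact aestronglyMeasurable_finsetProd_of_forall fun z hz =>
        (hg z).comp_aestronglyMeasurable (aestronglyMeasurable_levyField_sheetPast hLm Ψ θ
          (hε n) z.1.2.1 z.2.2.1 (hF z hz))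
    have hφ1 : ∀ ω, ‖φ ω‖ ≤ 1 := fun ω => by
      rw [hφ, Complex.norm_real, Real.norm_of_nonneg (Finset.prod_nonneg fun z _ => hg0 z _)]
      exact Finset.prod_le_one (fun z _ => hg0 z _) fun z _ => hg1 z _
    have hDb : ∀ z : ParamRect S T, ∃ M : ℝ, ∀ ω, ‖levyField L Ψ θ (ε n) z.1 z.2 ω‖ ≤ M := by
      intro z
      refine ⟨‖((ε n : ℝ) : ℂ) * (levyConst Ψ θ : ℂ)‖ * ((Real.sqrt (z.1 / ε n * (z.2 / ε n)) * 2) *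
        (volume : Measure (ℝ × ℝ)).real (Set.Ioc 0 (z.2 / ε n) ×ˢ Set.Ioc 0 (z.1 / ε n))),
        fun ω => ?_⟩
      rw [levyField_eq_box hLm Ψ θ (hε n) z.1.2.1 z.2.2.1, norm_mul]
      refine mul_le_mul_of_nonneg_left ?_ (norm_nonneg _)
      refine norm_setIntegral_le_of_norm_le_const ?_ fun p hp =>
        norm_levyIntegrand_le_box L θ ω hp.2 hp.1
      rw [Measure.volume_eq_prod, Measure.prod_prod]
      exact ENNReal.mul_lt_top measure_Ioc_lt_top measure_Ioc_lt_top
    have hfi : ∀ z : ParamRect S T, Integrable (levyField L Ψ θ (ε n) z.1 z.2) (μ : Measure Ω) :=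
      fun z => (hDb z).elim fun M hM => Integrable.of_bound
        (measurable_levyField hLm Ψ θ (hε n) z.1.2.1 z.2.2.1).aestronglyMeasurable M
        (ae_of_all _ hM)
    have hDi : Integrable D (μ : Measure Ω) :=
      (((hfi (s', t')).sub (hfi (s, t'))).sub (hfi (s', t))).add (hfi (s, t))
    have hφDi : Integrable (fun ω => φ ω * D ω) (μ : Measure Ω) :=
      hDi.bdd_mul (hφm.mono (sheetPast_le (measurable_sheet hLm) _ _)) (ae_of_all _ hφ1)
    -- The test function is real, so the real-linear `ρ` commutes with multiplication by it and with
    -- the integral. One complex estimate serves both real and imaginary parts.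
    have heq : ∫ ω, (∏ z ∈ F, g z (levyPath hLm Ψ θ S T (hε n) ω z)) *
        ρ (pathIncrement s s' t t' (levyPath hLm Ψ θ S T (hε n) ω)) ∂(μ : Measure Ω) =
        ρ (∫ ω, φ ω * D ω ∂(μ : Measure Ω)) := by
      rw [← ρ.integral_comp_comm hφDi]
      refine integral_congr_ae (ae_of_all _ fun ω => ?_)
      simp only [hφ]
      rw [← Complex.real_smul, map_smul, smul_eq_mul]
      rfl
    rw [heq]
    refine (hρ _).trans (Real.le_sqrt_of_sq_le ?_)
    have h := enorm_integral_past_mul_increment_sq_le hL hLm ha (hε n) hs hss ht htt hφm hφ1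
    rw [← ofReal_norm, ← ENNReal.ofReal_pow (norm_nonneg _)] at h
    exact (ENNReal.ofReal_le_ofReal_iff (mul_nonneg hc0 (hε n).le)).1 h
  have hlim : Tendsto (fun n => Real.sqrt (c * ε n)) atTop (𝓝 0) := by
    have := (Real.continuous_sqrt.tendsto _).comp (hε0.const_mul c)
    simpa [Function.comp_def] using this
  exact squeeze_zero_norm hbound hlim

end LevyLaw

/-! ### The strong martingale property of the limit -/

section Limit

variable {Ω : Type*} [m0 : MeasurableSpace Ω] {L : ℝ≥0 → ℝ≥0 → Ω → ℝ} {Ψ : ℝ → ℂ}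
  {μ : ProbabilityMeasure Ω} {S T : ℝ}

/-- Paths vanishing on the axes form a closed set of full measure under every approximating law; the
portmanteau theorem preserves this. -/
theorem ae_zero_on_axes_of_tendsto
    (hLm : Measurable fun p : (ℝ≥0 × ℝ≥0) × Ω => L p.1.1 p.1.2 p.2) {θ : ℝ}
    {ε : ℕ → ℝ} (hε : ∀ n, 0 < ε n) {P : ProbabilityMeasure (PathSpace S T)}
    (hP : Tendsto (fun n => levyLaw μ hLm Ψ θ S T (hε n)) atTop (𝓝 P)) :
    ∀ᵐ w ∂(P : Measure (PathSpace S T)),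
      ∀ z : ParamRect S T, (z.1 : ℝ) = 0 ∨ (z.2 : ℝ) = 0 → w z = 0 := by
  set Z : Set (PathSpace S T) :=
    {w | ∀ z : ParamRect S T, (z.1 : ℝ) = 0 ∨ (z.2 : ℝ) = 0 → w z = 0} with hZ
  have hclosed : IsClosed Z := by
    have : Z = ⋂ (z : ParamRect S T) (_ : (z.1 : ℝ) = 0 ∨ (z.2 : ℝ) = 0), {w | w z = 0} := by
      ext w
      simp [hZ]
    rw [this]
    exact isClosed_iInter fun z => isClosed_iInter fun _ =>
      isClosed_eq (by fun_prop) continuous_const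
  have hone : ∀ n, (levyLaw μ hLm Ψ θ S T (hε n) : Measure (PathSpace S T)) Z = 1 := by
    intro n
    rw [levyLaw_toMeasure, Measure.map_apply (measurable_levyPath hLm Ψ θ S T (hε n))
      hclosed.measurableSet]
    have : levyPath hLm Ψ θ S T (hε n) ⁻¹' Z = Set.univ := by
      refine Set.eq_univ_of_forall fun ω z hz => ?_
      change levyField L Ψ θ (ε n) z.1 z.2 ω = 0
      rcases hz with hz | hz <;> simp [levyField, hz]
    rw [this, measure_univ]
  have h := ProbabilityMeasure.limsup_measure_closed_le_of_tendsto hP hclosed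
  simp only [hone, limsup_const] at h
  exact (prob_compl_eq_zero_iff hclosed.measurableSet).2 (le_antisymm prob_le_one h)

/-- The past σ-algebra is generated by closed cylinders at points left of s or below t, precisely
the points allowed in the asymptotic orthogonality. -/
theorem setIntegral_increment_eq_zero_of_tendsto (hL : IsLevySheet L Ψ (μ : Measure Ω))
    (hLm : Measurable fun p : (ℝ≥0 × ℝ≥0) × Ω => L p.1.1 p.1.2 p.2) {θ : ℝ}
    (ha : 0 < (Ψ θ).re) (hS : 0 ≤ S) (hT : 0 ≤ T) {ρ : ℂ →L[ℝ] ℝ} (hρ : ∀ x, |ρ x| ≤ ‖x‖)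
    {ε : ℕ → ℝ} (hε : ∀ n, 0 < ε n)
    (hε0 : Tendsto ε atTop (𝓝 0)) {P : ProbabilityMeasure (PathSpace S T)}
    (hP : Tendsto (fun n => levyLaw μ hLm Ψ θ S T (hε n)) atTop (𝓝 P))
    {s s' : Set.Icc (0 : ℝ) S} {t t' : Set.Icc (0 : ℝ) T}
    (hs : 0 < (s : ℝ)) (ht : 0 < (t : ℝ)) (hss : s ≤ s') (htt : t ≤ t') {A : Set (PathSpace S T)}
    (hA : MeasurableSet[canonicalFiltration S T (rightEnd s, t) ⊔
      canonicalFiltration S T (s, rightEnd t)] A) :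
    ∫ w in A, ρ (pathIncrement s s' t t' w) ∂(P : Measure (PathSpace S T)) = 0 := by
  have hcont : Continuous fun w : PathSpace S T => ρ (pathIncrement s s' t t' w) :=
    ρ.continuous.comp (continuous_pathIncrement s s' t t')
  have hC : 0 ≤ 16 * (32 * levyConst Ψ θ ^ 2 / (Ψ θ).re ^ 2 * (S * T)) := by positivity
  have hb := fun n => lintegral_levyLaw_increment_sq_le (μ := μ) hL hLm ha hρ (hε n) s s' t t'
  have hA' : MeasurableSet[MeasurableSpace.generateFrom
      (closedCylinders {z : ParamRect S T | z.1 ≤ s ∨ z.2 ≤ t})] A :=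
    sup_le (canonicalFiltration_le fun z hz => Or.inr hz.2)
      (canonicalFiltration_le fun z hz => Or.inl hz.1) _ hA
  refine setIntegral_eq_zero_of_closedCylinders (integrable_of_lintegral_sq_le hC hcont.measurable
    (lintegral_sq_le_of_tendsto hP hcont hb)) _ (fun F g hF hg hg0 hg1 => ?_) hA'
  refine integral_mul_eq_zero_of_tendsto hP hcont hC hb
    (continuous_finsetProd _ fun z _ => (hg z).comp (by fun_prop)) (fun w => ?_)
    (tendsto_integral_levyLaw_increment hL hLm ha hρ hε hε0 hs ht hss htt
      (fun z hz => hF hz) hg hg0 hg1)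
  rw [abs_of_nonneg (Finset.prod_nonneg fun z _ => hg0 z _)]
  exact Finset.prod_le_one (fun z _ => hg0 z _) fun z _ => hg1 z _

theorem Set.Icc.exists_seq_tendsto_of_lt {R : ℝ} {u v : Set.Icc (0 : ℝ) R} (h : u < v) :
    ∃ f : ℕ → Set.Icc (0 : ℝ) R, (∀ n, u < f n ∧ f n ≤ v) ∧ Tendsto f atTop (𝓝 u) := by
  have hnf : ∀ n : ℕ, (0 : ℝ) < 1 / (n + 1) ∧ (1 : ℝ) / (n + 1) ≤ 1 := fun n =>
    ⟨by positivity, by rw [div_le_one (by positivity)]; linarith [(Nat.cast_nonneg n : (0 : ℝ) ≤ n)]⟩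
  have hlt : (0 : ℝ) < v - u := sub_pos.2 h
  have hle : ∀ n : ℕ, (u : ℝ) + (v - u) * (1 / (n + 1)) ≤ v := fun n => by
    nlinarith [(hnf n).2]
  have hgt : ∀ n : ℕ, (u : ℝ) < u + (v - u) * (1 / (n + 1)) := fun n =>
    lt_add_of_pos_right _ (mul_pos hlt (hnf n).1)
  refine ⟨fun n => ⟨u + (v - u) * (1 / (n + 1)), u.2.1.trans (hgt n).le, (hle n).trans v.2.2⟩,
    fun n => ⟨hgt n, hle n⟩, ?_⟩
  rw [tendsto_subtype_rng]
  simpa using (tendsto_one_div_add_atTop_nhds_zero_nat.const_mul ((v : ℝ) - u)).const_add (u : ℝ)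

/-- The limit process is a strong martingale with respect to every filtration that lies, up to null
sets, between the canonical filtration and its right-continuous version. -/
theorem isStrongMartingale_of_tendsto (hL : IsLevySheet L Ψ (μ : Measure Ω))
    (hLm : Measurable fun p : (ℝ≥0 × ℝ≥0) × Ω => L p.1.1 p.1.2 p.2) {θ : ℝ}
    (ha : 0 < (Ψ θ).re) (hS : 0 ≤ S) (hT : 0 ≤ T) {ρ : ℂ →L[ℝ] ℝ} (hρ : ∀ x, |ρ x| ≤ ‖x‖)
    {ε : ℕ → ℝ} (hε : ∀ n, 0 < ε n)
    (hε0 : Tendsto ε atTop (𝓝 0)) {P : ProbabilityMeasure (PathSpace S T)}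
    (hP : Tendsto (fun n => levyLaw μ hLm Ψ θ S T (hε n)) atTop (𝓝 P))
    (G : Filtration (ParamRect S T) (pathSpaceMeasurableSpace S T))
    (hG : ∀ z, canonicalFiltration S T z ≤ G z)
    (hGr : ∀ s u : Set.Icc (0 : ℝ) S, ∀ t v : Set.Icc (0 : ℝ) T, s < u → t < v →
      G (rightEnd s, t) ⊔ G (s, rightEnd t) ≤
        eventuallyMeasurableSpace (canonicalFiltration S T (rightEnd u, v) ⊔
          canonicalFiltration S T (u, rightEnd v)) (ae (P : Measure (PathSpace S T)))) :
    IsStrongMartingale (fun z (w : PathSpace S T) => ρ (canonicalProcess z w)) G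
      (P : Measure (PathSpace S T)) where
  adapted z := by
    have h1 : Measurable[canonicalFiltration S T z] (canonicalProcess (S := S) (T := T) z) :=
      (Filtration.stronglyAdapted_natural stronglyMeasurable_canonicalProcess z).measurable
    exact ρ.continuous.measurable.comp (h1.mono (hG z) le_rfl)
  integrable z := by
    have hcont : Continuous fun w : PathSpace S T => ρ (w z) := by fun_prop
    refine integrable_of_lintegral_sq_le (C := 32 * levyConst Ψ θ ^ 2 / (Ψ θ).re ^ 2 * (S * T))
      (by positivity) hcont.measurable (lintegral_sq_le_of_tendsto hP hcont fun n => ?_)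
    refine (lintegral_mono fun w => ?_).trans
      (lintegral_levyLaw_enorm_sq_le (μ := μ) hL hLm ha (hε n) z)
    have h1 : ‖ρ (w z)‖ₑ ≤ ‖w z‖ₑ := by
      rw [← ofReal_norm, ← ofReal_norm]
      exact ENNReal.ofReal_le_ofReal (hρ _)
    gcongr
  zero_on_axes := by
    filter_upwards [ae_zero_on_axes_of_tendsto hLm hε hP] with w hw z hz
    simp [canonicalProcess, hw z hz]
  condExp_increment s s' t t' hss htt := by
    have hcont : ∀ (a a' : Set.Icc (0 : ℝ) S) (b b' : Set.Icc (0 : ℝ) T),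
        Continuous fun w : PathSpace S T => ρ (pathIncrement a a' b b' w) := fun a a' b b' =>
      ρ.continuous.comp (continuous_pathIncrement a a' b b')
    have hC : 0 ≤ 16 * (32 * levyConst Ψ θ ^ 2 / (Ψ θ).re ^ 2 * (S * T)) := by positivity
    have hb : ∀ (a a' : Set.Icc (0 : ℝ) S) (b b' : Set.Icc (0 : ℝ) T), _ := fun a a' b b' =>
      lintegral_sq_le_of_tendsto hP (hcont a a' b b') fun n =>
        lintegral_levyLaw_increment_sq_le (μ := μ) hL hLm ha hρ (hε n) a a' b b'
    have hle : G (rightEnd s, t) ⊔ G (s, rightEnd t) ≤ pathSpaceMeasurableSpace S T :=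
      sup_le (G.le _) (G.le _)
    have hi := integrable_of_lintegral_sq_le hC (hcont s s' t t').measurable (hb s s' t t')
    rw [rectIncrement_eq]
    refine (ae_eq_condExp_of_forall_setIntegral_eq hle hi (fun _ _ _ => integrableOn_zero)
      (fun A hA _ => ?_) stronglyMeasurable_zero.aestronglyMeasurable).symm
    -- The corner (s,t) is approximated by strictly larger corners. Their coordinates are positive
    -- even if s or t is 0, and `hGr` puts the conditioning σ-algebra inside the canonical past of
    -- each, up to null sets.
    obtain ⟨u, hu, hu0⟩ := Set.Icc.exists_seq_tendsto_of_lt hss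
    obtain ⟨v, hv, hv0⟩ := Set.Icc.exists_seq_tendsto_of_lt htt
    rw [setIntegral_eq_zero_of_tendsto hC
      (f := fun n w => ρ (pathIncrement (u n) s' (v n) t' w))
      (fun n => (hcont _ _ _ _).measurable) (hcont _ _ _ _).measurable (fun n => hb _ _ _ _)
      (hb _ _ _ _) (fun w => ?_) (hle _ hA) fun n => ?_]
    · simp
    · refine (ρ.continuous.tendsto _).comp ?_
      have hw : ∀ {f : ℕ → ParamRect S T} {z : ParamRect S T}, Tendsto f atTop (𝓝 z) →
          Tendsto (fun n => w (f n)) atTop (𝓝 (w z)) := fun h =>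
        (w.continuous.tendsto _).comp h
      exact ((tendsto_const_nhds.sub (hw (hu0.prodMk_nhds tendsto_const_nhds))).sub
        (hw (tendsto_const_nhds.prodMk_nhds hv0))).add (hw (hu0.prodMk_nhds hv0))
    · obtain ⟨B, hB, hAB⟩ := hGr s (u n) t (v n) (hu n).1 (hv n).1 _ hA
      rw [setIntegral_congr_set hAB]
      exact setIntegral_increment_eq_zero_of_tendsto hL hLm ha hS hT hρ hε hε0 hP
        (lt_of_le_of_lt s.2.1 (hu n).1) (lt_of_le_of_lt t.2.1 (hv n).1) (hu n).2 (hv n).2 hB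

end Limit

/-! ### Comparison of the natural and the augmented filtration -/

section Filtrations

variable {S T : ℝ} (P : Measure (PathSpace S T))

/-- Sets agreeing almost everywhere with a set of m form a σ-algebra, and a null set agrees with ∅.
-/
theorem sup_nullSets_le_eventuallyMeasurableSpace {E : Type*} {m m0 : MeasurableSpace E}
    (P : Measure E) :
    m ⊔ MeasurableSpace.generateFrom {A : Set E | MeasurableSet[m0] A ∧ P A = 0} ≤
      eventuallyMeasurableSpace m (ae P) := by
  refine sup_le le_eventuallyMeasurableSpace (MeasurableSpace.generateFrom_le fun A hA => ?_)
  exact ⟨∅, @MeasurableSet.empty _ m, ae_eq_empty.2 hA.2⟩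

theorem eventuallyMeasurableSpace_mono {E : Type*} {m m' : MeasurableSpace E} (h : m ≤ m')
    (l : Filter E) [CountableInterFilter l] :
    eventuallyMeasurableSpace m l ≤ eventuallyMeasurableSpace m' l :=
  fun _ ⟨B, hB, hAB⟩ => ⟨B, h _ hB, hAB⟩

theorem le_augmentedFiltration (F : Filtration (ParamRect S T) (pathSpaceMeasurableSpace S T))
    (z : ParamRect S T) : F z ≤ augmentedFiltration P F z := by
  refine le_iInf₂ fun w hw => (F.mono ⟨?_, ?_⟩).trans le_sup_left
  · rcases hw.1 with h | h
    · exact h.le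
    · rw [h]
      exact z.1.2.2
  · rcases hw.2 with h | h
    · exact h.le
    · rw [h]
      exact z.2.2.2

theorem filtration_sup_le
    (F : Filtration (ParamRect S T) (pathSpaceMeasurableSpace S T)) {s u : Set.Icc (0 : ℝ) S}
    {t v : Set.Icc (0 : ℝ) T} (hsu : s ≤ u) (htv : t ≤ v) :
    F (rightEnd s, t) ⊔ F (s, rightEnd t) ≤
      eventuallyMeasurableSpace (F (rightEnd u, v) ⊔ F (u, rightEnd v)) (ae P) := by
  have h1 : F (rightEnd s, t) ≤ F (rightEnd u, v) := F.mono ⟨le_rfl, htv⟩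
  have h2 : F (s, rightEnd t) ≤ F (u, rightEnd v) := F.mono ⟨hsu, le_rfl⟩
  exact le_trans (sup_le_sup h1 h2) le_eventuallyMeasurableSpace

/-- The infimum defining each augmented σ-algebra is bounded by one of its members. The coordinate
at its end point is kept there, and only the other one moves strictly, from t to v or from s to u.
-/
theorem augmentedFiltration_sup_le
    (F : Filtration (ParamRect S T) (pathSpaceMeasurableSpace S T)) {s u : Set.Icc (0 : ℝ) S}
    {t v : Set.Icc (0 : ℝ) T} (hsu : s < u) (htv : t < v) :
    augmentedFiltration P F (rightEnd s, t) ⊔ augmentedFiltration P F (s, rightEnd t) ≤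
      eventuallyMeasurableSpace (F (rightEnd u, v) ⊔ F (u, rightEnd v)) (ae P) := by
  refine sup_le ?_ ?_
  · refine (iInf₂_le (rightEnd u, v) ⟨Or.inr rfl, Or.inl htv⟩).trans ?_
    exact (sup_nullSets_le_eventuallyMeasurableSpace P).trans
      (eventuallyMeasurableSpace_mono le_sup_left _)
  · refine (iInf₂_le (u, rightEnd v) ⟨Or.inl hsu, Or.inr rfl⟩).trans ?_
    exact (sup_nullSets_le_eventuallyMeasurableSpace P).trans
      (eventuallyMeasurableSpace_mono le_sup_right _)

end Filtrations

theorem proposition4p2 {Ω : Type*} [MeasurableSpace Ω] (μ : ProbabilityMeasure Ω)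
    (L : ℝ≥0 → ℝ≥0 → Ω → ℝ) (Ψ : ℝ → ℂ) (hL : IsLevySheet L Ψ (μ : Measure Ω))
    (hLmeas : Measurable fun p : (ℝ≥0 × ℝ≥0) × Ω => L p.1.1 p.1.2 p.2)
    (θ : ℝ) (hθ : θ ∈ Set.Ioo 0 (2 * Real.pi)) (ha : (Ψ θ).re ≠ 0)
    (S T : ℝ) (hS : 0 < S) (hT : 0 < T)
    (ε : ℕ → ℝ) (hε : ∀ n, 0 < ε n) (hε0 : Tendsto ε atTop (𝓝 0))
    (P : ProbabilityMeasure (PathSpace S T))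
    (hP : Tendsto (fun n => levyLaw μ hLmeas Ψ θ S T (hε n)) atTop (𝓝 P)) :
    (IsStrongMartingale (fun z (w : PathSpace S T) => (canonicalProcess z w).re)
        (canonicalFiltration S T) (P : Measure (PathSpace S T)) ∧
      IsStrongMartingale (fun z (w : PathSpace S T) => (canonicalProcess z w).im)
        (canonicalFiltration S T) (P : Measure (PathSpace S T))) ∧
    (IsStrongMartingale (fun z (w : PathSpace S T) => (canonicalProcess z w).re)
        (augmentedFiltration (P : Measure (PathSpace S T)) (canonicalFiltration S T))
        (P : Measure (PathSpace S T)) ∧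
      IsStrongMartingale (fun z (w : PathSpace S T) => (canonicalProcess z w).im)
        (augmentedFiltration (P : Measure (PathSpace S T)) (canonicalFiltration S T))
        (P : Measure (PathSpace S T))) := by
  have hre : ∀ x : ℂ, |Complex.reCLM x| ≤ ‖x‖ := Complex.abs_re_le_norm
  have him : ∀ x : ℂ, |Complex.imCLM x| ≤ ‖x‖ := Complex.abs_im_le_norm
  -- Nonnegativity is automatic, so nonvanishing already gives the strict decay of correlations.
  have hpos : 0 < (Ψ θ).re := (hL.re_exponent_nonneg θ).lt_of_ne' ha
  have hcan := fun (s u : Set.Icc (0 : ℝ) S) (t v : Set.Icc (0 : ℝ) T) (hsu : s < u)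
    (htv : t < v) => filtration_sup_le (P : Measure (PathSpace S T))
      (canonicalFiltration S T) hsu.le htv.le
  have haug := fun (s u : Set.Icc (0 : ℝ) S) (t v : Set.Icc (0 : ℝ) T) (hsu : s < u)
    (htv : t < v) => augmentedFiltration_sup_le (P : Measure (PathSpace S T))
      (canonicalFiltration S T) hsu htv
  have hle := le_augmentedFiltration (P : Measure (PathSpace S T)) (canonicalFiltration S T)
  exact ⟨⟨isStrongMartingale_of_tendsto hL hLmeas hpos hS.le hT.le hre hε hε0 hP _
      (fun _ => le_rfl) hcan,
    isStrongMartingale_of_tendsto hL hLmeas hpos hS.le hT.le him hε hε0 hP _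
      (fun _ => le_rfl) hcan⟩,
    isStrongMartingale_of_tendsto hL hLmeas hpos hS.le hT.le hre hε hε0 hP _ hle haug,
    isStrongMartingale_of_tendsto hL hLmeas hpos hS.le hT.le him hε hε0 hP _ hle haug⟩
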